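/- Let $k$ be a field and let $E$ be an elliptic curve over $k$, with origin $0$, given by a nonsingular Weierstrass equation. Let $\mathrm{Aut}_0(E)$ be the group of automorphisms of the $k$-variety $E$ that fix $0$. Let it act on the function field $k(E)$, and for $n\ge 0$ let $\Gamma(E;\mathcal L(n[0]))\subset k(E)$ denote the space of rational functions on $E$ that are regular away from $0$ and have at $0$ a pole of order at most $n$; this subspace is preserved by $\mathrm{Aut}_0(E)$. Let $G\subset \mathrm{Aut}_0(E)$ be a nontrivial subgroup and let $m$ be a positive integer dividing $|G|$. Then there is an isomorphism of graded $k$-algebras $$\bigoplus_{d\ge 0}\Gamma(E;\mathcal L(dm[0]))^G\;\cong\; k[x,y],$$ where the left side is multiplied by multiplying functions, $k[x,y]$ is the polynomial ring in two variables, and the grading is given by $\deg x=1$, $\deg y=|G|/m$. -/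

import Mathlib

open scoped DirectSum

namespace EllipticInvariants

noncomputable section

variable {k : Type*} [Field k] (W : WeierstrassCurve k)

/-- The function field `k(E)` of the curve `E : Y² + a₁XY + a₃Y = X³ + a₂X² + a₄X + a₆`. -/
abbrev FunField := W.toAffine.FunctionField

/-- The coordinate function `x` on `E`. -/
def xFun : FunField W :=
  algebraMap W.toAffine.CoordinateRing (FunField W)
    (WeierstrassCurve.Affine.CoordinateRing.mk W.toAffine (Polynomial.C Polynomial.X))

/-- The coordinate function `y` on `E`. -/
def yFun : FunField W :=
  algebraMap W.toAffine.CoordinateRing (FunField W)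
    (WeierstrassCurve.Affine.CoordinateRing.mk W.toAffine Polynomial.X)

/-- The value `F(x, y, 1)` in the function field of a form `F(X, Y, Z)`: the dehomogenization
of `F`, restricted to the curve `E ⊂ ℙ²`. -/
def evalForm : MvPolynomial (Fin 3) k →ₐ[k] FunField W :=
  MvPolynomial.aeval ![xFun W, yFun W, 1]

/-- The ring `Γ(E ∖ {0}, 𝒪)` of functions that are regular away from the origin
(the affine coordinate ring `k[x, y]`), inside the function field. -/
def regularAwayFromZero : Subalgebra k (FunField W) :=
  (IsScalarTower.toAlgHom k W.toAffine.CoordinateRing (FunField W)).range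

/-- The local ring `𝒪_{E,0}` of `E ⊂ ℙ²` at the origin `0 = [0 : 1 : 0]`, inside the function
field: quotients `F / G` of forms of the same degree such that `G` does not vanish at `0`. -/
def localRingAtZero : Subalgebra k (FunField W) where
  carrier := {f | ∃ (d : ℕ) (F G : MvPolynomial (Fin 3) k), F.IsHomogeneous d ∧
    G.IsHomogeneous d ∧ MvPolynomial.eval ![0, 1, 0] G ≠ 0 ∧ evalForm W G ≠ 0 ∧
    f = evalForm W F / evalForm W G}
  mul_mem' := by
    rintro _ _ ⟨d, F, G, hF, hG, h0, h1, rfl⟩ ⟨d', F', G', hF', hG', h0', h1', rfl⟩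
    refine ⟨d + d', F * F', G * G', hF.mul hF', hG.mul hG', ?_, ?_, ?_⟩
    · rw [map_mul]; exact mul_ne_zero h0 h0'
    · rw [map_mul]; exact mul_ne_zero h1 h1'
    · rw [map_mul, map_mul]; field_simp
  add_mem' := by
    rintro _ _ ⟨d, F, G, hF, hG, h0, h1, rfl⟩ ⟨d', F', G', hF', hG', h0', h1', rfl⟩
    refine ⟨d + d', F * G' + G * F', G * G', (hF.mul hG').add (hG.mul hF'),
      hG.mul hG', ?_, ?_, ?_⟩
    · rw [map_mul]; exact mul_ne_zero h0 h0'
    · rw [map_mul]; exact mul_ne_zero h1 h1'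
    · rw [map_add, map_mul, map_mul, map_mul]; field_simp
  algebraMap_mem' := by
    intro c
    refine ⟨0, MvPolynomial.C c, 1, MvPolynomial.isHomogeneous_C _ _,
      MvPolynomial.isHomogeneous_one _ _, by simp, by simp, ?_⟩
    rw [map_one, div_one, ← MvPolynomial.algebraMap_eq, AlgHom.commutes]

/-- `Aut₀(E)`: the group of automorphisms of the `k`-variety `E` that fix the origin `0`,
acting on functions. An automorphism of the curve is determined by the automorphism of the
function field that it induces; the latter comes from an automorphism of the curve that fixes
`0` exactly when it preserves the local ring at `0` and the ring of functions on `E ∖ {0}`. -/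
def originAut : Subgroup (FunField W ≃ₐ[k] FunField W) where
  carrier := {σ | (∀ f, σ f ∈ localRingAtZero W ↔ f ∈ localRingAtZero W) ∧
    ∀ f, σ f ∈ regularAwayFromZero W ↔ f ∈ regularAwayFromZero W}
  mul_mem' := by
    rintro σ τ ⟨h1, h2⟩ ⟨h1', h2'⟩
    exact ⟨fun f => (h1 (τ f)).trans (h1' f), fun f => (h2 (τ f)).trans (h2' f)⟩
  one_mem' := ⟨fun _ => Iff.rfl, fun _ => Iff.rfl⟩
  inv_mem' := by
    rintro σ ⟨h1, h2⟩
    refine ⟨fun f => ?_, fun f => ?_⟩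
    · rw [← h1]; exact Iff.of_eq (congrArg (· ∈ localRingAtZero W) (σ.apply_symm_apply f))
    · rw [← h2]; exact Iff.of_eq (congrArg (· ∈ regularAwayFromZero W) (σ.apply_symm_apply f))

/-- `Γ(E; 𝓛(n[0]))`: the functions that are regular away from `0` and have at `0` a pole of
order at most `n`, i.e. `f tⁿ` is regular at `0` for all `t` in the maximal ideal of `𝒪_{E,0}`. -/
def sections (n : ℕ) : Submodule k (FunField W) where
  carrier := {f | f ∈ regularAwayFromZero W ∧
    ∀ t ∈ nonunits (localRingAtZero W), f * (t : FunField W) ^ n ∈ localRingAtZero W}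
  add_mem' := by
    rintro f g ⟨hf, hf'⟩ ⟨hg, hg'⟩
    refine ⟨add_mem hf hg, fun t ht => ?_⟩
    rw [add_mul]
    exact add_mem (hf' t ht) (hg' t ht)
  zero_mem' := ⟨zero_mem _, fun t _ => by rw [zero_mul]; exact zero_mem _⟩
  smul_mem' := by
    rintro c f ⟨hf, hf'⟩
    refine ⟨Subalgebra.smul_mem _ hf c, fun t ht => ?_⟩
    rw [smul_mul_assoc]
    exact Subalgebra.smul_mem _ (hf' t ht) c

/-- `Γ(E; 𝓛(n[0]))^G`, for the equivariant structure given by the action on functions. -/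
def invariantSections (G : Subgroup (originAut W)) (n : ℕ) : Submodule k (FunField W) where
  carrier := {f | f ∈ sections W n ∧
    ∀ σ ∈ G, (σ : FunField W ≃ₐ[k] FunField W) f = f}
  add_mem' := by
    rintro f g ⟨hf, hf'⟩ ⟨hg, hg'⟩
    exact ⟨add_mem hf hg, fun σ hσ => by rw [map_add, hf' σ hσ, hg' σ hσ]⟩
  zero_mem' := ⟨zero_mem _, fun σ _ => map_zero _⟩
  smul_mem' := by
    rintro c f ⟨hf, hf'⟩
    exact ⟨Submodule.smul_mem _ c hf, fun σ hσ => by rw [map_smul, hf' σ hσ]⟩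

/-- Multiplication of functions takes degrees `d` and `d'` to degree `d + d'`. -/
instance invariantSections_gradedMonoid (G : Subgroup (originAut W)) (m : ℕ) :
    SetLike.GradedMonoid (fun d : ℕ => invariantSections W G (d * m)) where
  one_mem := by
    refine ⟨⟨one_mem _, fun t _ => ?_⟩, fun σ _ => map_one _⟩
    rw [zero_mul, pow_zero, one_mul]
    exact one_mem _
  mul_mem := by
    rintro d d' f g ⟨⟨hf, hf'⟩, hfG⟩ ⟨⟨hg, hg'⟩, hgG⟩
    refine ⟨⟨mul_mem hf hg, fun t ht => ?_⟩, fun σ hσ => by rw [map_mul, hfG σ hσ, hgG σ hσ]⟩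
    rw [add_mul, pow_add, mul_mul_mul_comm]
    exact mul_mem (hf' t ht) (hg' t ht)

/-- The graded `k`-algebra `⨁_{d ≥ 0} Γ(E; 𝓛(dm[0]))^G`. -/
abbrev InvariantRing (G : Subgroup (originAut W)) (m : ℕ) :=
  ⨁ d : ℕ, invariantSections W G (d * m)

end

end EllipticInvariants

/-!
Let `R` be the affine coordinate ring `k[x, y]`. The degree over `k[x]` of the norm of `a ∈ R` is the
order of the pole of `a` at the origin; it is multiplicative, and it takes every value but `1`.
Writing functions as quotients of forms shows that `a / b` is regular at the origin exactly when the
pole of `a` is of order at most that of `b` (`div_mem_localRingAtZero`), so that the space of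
sections of `𝓛(n[0])` consists of the elements of `R` of pole order at most `n` (`mem_sections`).

An automorphism fixing the origin preserves these spaces, hence acts on `x` and `y` by a change of
variables `x ↦ u²x + r`, `y ↦ u³y + u²sx + t` that fixes the Weierstrass equation. There are only
finitely many of these (`finite_smul_eq_self`), so `G` is finite; let `n` be its order.

The key point (`exists_generator`) is that the invariants of `G` in `R` form a polynomial ring
`k[a]` with `a` of pole order `n`. Let `h` be the size of the orbit of `x`.
* If some element of `G` other than `1` fixes `x`, it generates the stabilizer of `x`, which is of
  order two and has the invariants `k[x]`. So `n = 2h`, and the product of the orbit of `x` is an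
  invariant `a ∈ k[x]` of pole order `2h`.
* Otherwise `n = h`, and the action on equations in characteristic two and in the other
  characteristics shows that `u³ = 1` throughout `G` and that there is an invariant `a` of pole
  order `3`: the function `2y + a₁x + a₃`, or in characteristic two a trace of `y`. Comparing pole
  orders, `1, x, x²` generate `R` over `k[a]`; thus `x` is a root of a monic cubic over `k[a]`,
  which bounds its orbit, so `n ≤ 3`; and `n = 2` is excluded by `u² = 1 = u³`.

In both cases pole orders show that every invariant is of the form `b = ∑_{i < h} cᵢ xⁱ` with
`cᵢ ∈ k[a]`. The polynomial `∑ cᵢ Tⁱ - b` has invariant coefficients, so it vanishes at the `h`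
conjugates of `x`; being of degree less than `h` it is zero, and `b = c₀ ∈ k[a]`
(`exists_aeval_eq_of_mem_span`).

Since `aʲ` has pole order `jn`, the invariant sections of `𝓛(dm[0])` have the basis `aʲ` with
`j (n / m) ≤ d`. These are the images of the monomials `x^(d - j (n / m)) yʲ` of weight `d`, if `x`
is sent to the function `1` in degree `1` and `y` to `a` in degree `n / m`.
-/

namespace EllipticInvariants

noncomputable section

open Polynomial WeierstrassCurve.Affine

variable {k : Type*} [Field k] {W : WeierstrassCurve k}

/-! ### Pole orders on the affine coordinate ring -/

variable (W) in
/-- The coordinate ring of the affine curve `E ∖ {0}`. -/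
abbrev CRing := W.toAffine.CoordinateRing

variable (W) in
/-- The coordinate function `x`, as an element of the coordinate ring. -/
def xCoord : CRing W := CoordinateRing.mk W.toAffine (C X)

variable (W) in
/-- The coordinate function `y`, as an element of the coordinate ring. -/
def yCoord : CRing W := CoordinateRing.mk W.toAffine X

theorem smul_one_add_smul_yCoord (p q : k[X]) :
    p • (1 : CRing W) + q • yCoord W = aeval (xCoord W) p + aeval (xCoord W) q * yCoord W := by
  have h : ∀ p : k[X], CoordinateRing.mk W.toAffine (C p) = aeval (xCoord W) p := by
    intro p
    have : (Polynomial.aeval (xCoord W)) = (IsScalarTower.toAlgHom k k[X] (CRing W)) := by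
      apply Polynomial.algHom_ext
      simp [xCoord]
    rw [this]
    rfl
  rw [CoordinateRing.smul, CoordinateRing.smul, h, h, mul_one]

theorem exists_eq_aeval_add (a : CRing W) :
    ∃ p q : k[X], a = aeval (xCoord W) p + aeval (xCoord W) q * yCoord W := by
  obtain ⟨p, q, h⟩ := CoordinateRing.exists_smul_basis_eq a
  exact ⟨p, q, by rw [← h, ← smul_one_add_smul_yCoord]; rfl⟩

theorem aeval_add_eq_zero {p q : k[X]}
    (h : aeval (xCoord W) p + aeval (xCoord W) q * yCoord W = 0) : p = 0 ∧ q = 0 :=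
  CoordinateRing.smul_basis_eq_zero (W' := W.toAffine) (by
    rw [← smul_one_add_smul_yCoord] at h; exact h)

/-- The order of the pole at the origin, computed as the degree in `x` of the norm to `k[x]`. By
convention the pole order of `0` is `0`. -/
def poleOrder (a : CRing W) : ℕ := (Algebra.norm k[X] a).natDegree

instance : Module.Finite k[X] (CRing W) := .of_basis (CoordinateRing.basis W.toAffine)

theorem poleOrder_mul {a b : CRing W} (ha : a ≠ 0) (hb : b ≠ 0) :
    poleOrder (a * b) = poleOrder a + poleOrder b := by
  unfold poleOrder
  rw [map_mul, natDegree_mul] <;> rwa [Algebra.norm_ne_zero_iff]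

theorem poleOrder_zero : poleOrder (0 : CRing W) = 0 := by
  rw [poleOrder, Algebra.norm_zero, natDegree_zero]

theorem poleOrder_one : poleOrder (1 : CRing W) = 0 := by
  simp [poleOrder]

theorem poleOrder_mul_le (a b : CRing W) : poleOrder (a * b) ≤ poleOrder a + poleOrder b := by
  unfold poleOrder
  rw [map_mul]
  exact natDegree_mul_le

theorem poleOrder_pow (a : CRing W) (n : ℕ) : poleOrder (a ^ n) = n * poleOrder a := by
  unfold poleOrder
  rw [map_pow, natDegree_pow]

theorem poleOrder_le_iff (p q : k[X]) (n : ℕ) :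
    poleOrder (aeval (xCoord W) p + aeval (xCoord W) q * yCoord W) ≤ n ↔
      2 * p.natDegree ≤ n ∧ (q = 0 ∨ 2 * q.natDegree + 3 ≤ n) := by
  rw [← smul_one_add_smul_yCoord, poleOrder, natDegree_le_iff_degree_le]
  erw [CoordinateRing.degree_norm_smul_basis (W' := W.toAffine) p q]
  rw [max_le_iff]
  apply and_congr
  · by_cases hp : p = 0
    · simp [hp]
    · rw [degree_eq_natDegree hp]
      rw [← Nat.cast_smul_eq_nsmul (WithBot ℕ), smul_eq_mul]
      norm_cast
  · by_cases hq : q = 0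
    · simp [hq]
    · rw [degree_eq_natDegree hq]
      rw [← Nat.cast_smul_eq_nsmul (WithBot ℕ), smul_eq_mul]
      simp only [hq, false_or]
      norm_cast

theorem poleOrder_ne_one (a : CRing W) : poleOrder a ≠ 1 :=
  CoordinateRing.natDegree_norm_ne_one a

theorem poleOrder_aeval (p : k[X]) : poleOrder (aeval (xCoord W) p) = 2 * p.natDegree := by
  refine eq_of_forall_ge_iff fun n => ?_
  simpa using poleOrder_le_iff (W := W) p 0 n

theorem poleOrder_xCoord : poleOrder (xCoord W) = 2 := by
  simpa using poleOrder_aeval (W := W) X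

theorem poleOrder_yCoord : poleOrder (yCoord W) = 3 := by
  refine eq_of_forall_ge_iff fun n => ?_
  simpa using poleOrder_le_iff (W := W) 0 1 n

theorem xCoord_ne_zero : xCoord W ≠ 0 := fun h => by
  simpa [h, poleOrder_zero] using poleOrder_xCoord (W := W)

theorem yCoord_ne_zero : yCoord W ≠ 0 := fun h => by
  simpa [h, poleOrder_zero] using poleOrder_yCoord (W := W)

theorem poleOrder_add_le {a b : CRing W} {n : ℕ} (ha : poleOrder a ≤ n) (hb : poleOrder b ≤ n) :
    poleOrder (a + b) ≤ n := by
  obtain ⟨p, q, rfl⟩ := exists_eq_aeval_add a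
  obtain ⟨p', q', rfl⟩ := exists_eq_aeval_add b
  have : aeval (xCoord W) p + aeval (xCoord W) q * yCoord W +
      (aeval (xCoord W) p' + aeval (xCoord W) q' * yCoord W) =
      aeval (xCoord W) (p + p') + aeval (xCoord W) (q + q') * yCoord W := by
    simp only [map_add]; ring
  rw [this]
  rw [poleOrder_le_iff] at *
  have h1 := natDegree_add_le p p'
  have h2 := natDegree_add_le q q'
  refine ⟨by omega, ?_⟩
  rcases ha.2 with rfl | h
  · simpa using hb.2
  · rcases hb.2 with rfl | h'
    · simpa using ha.2
    · omega

theorem poleOrder_smul_le (c : k) (a : CRing W) : poleOrder (c • a) ≤ poleOrder a := by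
  rw [Algebra.smul_def]
  refine (poleOrder_mul_le _ _).trans (le_of_eq ?_)
  have := poleOrder_aeval (W := W) (C c)
  rw [aeval_C, natDegree_C] at this
  omega

variable (W) in
/-- The elements of the coordinate ring with a pole of order at most `n` at the origin. -/
def functionsOfPoleOrderLE (n : ℕ) : Submodule k (CRing W) where
  carrier := {a | poleOrder a ≤ n}
  add_mem' := poleOrder_add_le
  zero_mem' := by simp [poleOrder_zero]
  smul_mem' c a h := (poleOrder_smul_le c a).trans h

theorem mem_functionsOfPoleOrderLE {n : ℕ} {a : CRing W} :
    a ∈ functionsOfPoleOrderLE W n ↔ poleOrder a ≤ n := Iff.rfl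

/-- Two functions with poles of the same order at the origin have proportional leading coefficients,
as the residue field is `k`. -/
theorem exists_poleOrder_sub_smul_lt {a b : CRing W} (hb : b ≠ 0)
    (h : poleOrder a = poleOrder b) :
    ∃ c : k, a = c • b ∨ poleOrder (a - c • b) < poleOrder b := by
  obtain ⟨p, q, rfl⟩ := exists_eq_aeval_add a
  obtain ⟨p', q', rfl⟩ := exists_eq_aeval_add b
  have key : ∀ c : k, aeval (xCoord W) p + aeval (xCoord W) q * yCoord W -
      c • (aeval (xCoord W) p' + aeval (xCoord W) q' * yCoord W) =
      aeval (xCoord W) (p - c • p') + aeval (xCoord W) (q - c • q') * yCoord W := by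
    intro c
    rw [map_sub, map_sub, map_smul, map_smul, smul_add, sub_mul, smul_mul_assoc]; ring
  suffices H : ∃ c : k,
      aeval (xCoord W) (p - c • p') + aeval (xCoord W) (q - c • q') * yCoord W = 0 ∨
      poleOrder (aeval (xCoord W) (p - c • p') + aeval (xCoord W) (q - c • q') * yCoord W) <
        poleOrder (aeval (xCoord W) p' + aeval (xCoord W) q' * yCoord W) by
    obtain ⟨c, hc⟩ := H
    exact ⟨c, by rwa [← sub_eq_zero, key]⟩
  set n := poleOrder (aeval (xCoord W) p' + aeval (xCoord W) q' * yCoord W) with hn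
  have ha := (poleOrder_le_iff (W := W) p q n).1 h.le
  have hb' := (poleOrder_le_iff (W := W) p' q' n).1 hn.ge
  -- the leading coefficient sits at `xⁱ` if `n = 2i`, and at `xⁱy` if `n = 2i + 3`
  have hlow : ∀ P Q : k[X], 2 * P.natDegree ≤ n → (Q = 0 ∨ 2 * Q.natDegree + 3 ≤ n) →
      (∀ i, n = 2 * i → P.coeff i = 0) → (∀ i, n = 2 * i + 3 → Q.coeff i = 0) →
      aeval (xCoord W) P + aeval (xCoord W) Q * yCoord W = 0 ∨
      poleOrder (aeval (xCoord W) P + aeval (xCoord W) Q * yCoord W) < n := by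
    intro P Q hP hQ hi hj
    have hP' : P = 0 ∨ 2 * P.natDegree + 1 ≤ n := by
      by_contra hc
      push Not at hc
      have := hi P.natDegree (by omega)
      exact hc.1 (leadingCoeff_eq_zero.1 this)
    have hQ' : Q = 0 ∨ 2 * Q.natDegree + 4 ≤ n := by
      by_contra hc
      push Not at hc
      have := hj Q.natDegree (by rcases hQ with h | h; exact absurd h hc.1; omega)
      exact hc.1 (leadingCoeff_eq_zero.1 this)
    by_cases hz : P = 0 ∧ Q = 0
    · left; simp [hz.1, hz.2]
    right
    have hpos : 0 < n := by
      by_contra h0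
      exact hz ⟨hP'.resolve_right (by omega), hQ'.resolve_right (by omega)⟩
    rw [Nat.lt_iff_le_pred hpos, poleOrder_le_iff]
    refine ⟨?_, ?_⟩
    · rcases hP' with rfl | h
      · simp
      · omega
    · rcases hQ' with rfl | h
      · simp
      · right; omega
  have hc : ∃ c : k, (∀ i, n = 2 * i → (p - c • p').coeff i = 0) ∧
      (∀ i, n = 2 * i + 3 → (q - c • q').coeff i = 0) := by
    have hb0 : ¬ ((∀ i, n = 2 * i → p'.coeff i = 0) ∧ (∀ i, n = 2 * i + 3 → q'.coeff i = 0)) := by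
      rintro ⟨h1, h2⟩
      rcases hlow p' q' hb'.1 hb'.2 h1 h2 with h | h
      · exact hb h
      · omega
    rcases Nat.even_or_odd' n with ⟨i, hi | hi⟩
    · refine ⟨p.coeff i / p'.coeff i, ?_, fun j hj => by omega⟩
      intro j hj
      obtain rfl : j = i := by omega
      have : p'.coeff j ≠ 0 := fun h0 => hb0
        ⟨fun l hl => by rwa [show l = j by omega], fun l hl => by omega⟩
      simp [this]
    · refine ⟨q.coeff (i - 1) / q'.coeff (i - 1), fun j hj => by omega, ?_⟩
      intro j hj
      obtain rfl : j = i - 1 := by omega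
      have : q'.coeff (i - 1) ≠ 0 := fun h0 => hb0
        ⟨fun l hl => by omega, fun l hl => by rwa [show l = i - 1 by omega]⟩
      simp [this]
  obtain ⟨c, h1, h2⟩ := hc
  refine ⟨c, hlow _ _ ?_ ?_ h1 h2⟩
  · have := natDegree_sub_le p (c • p')
    have := natDegree_smul_le c p'
    omega
  · have h3 := natDegree_sub_le q (c • q')
    have h4 := natDegree_smul_le c q'
    have h5 : (0 : k[X]).natDegree = 0 := natDegree_zero
    rcases ha.2 with rfl | h <;> rcases hb'.2 with rfl | h'
    · simp
    all_goals
      right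
      omega

/-- A family that realises every pole order occurring in `A` spans `A`: subtract multiples of its
members to lower the pole order. -/
theorem le_span_range_of_poleOrder {ι : Type*} (A : Submodule k (CRing W)) (b : ι → CRing W)
    (hbA : ∀ i, b i ∈ A) (hb0 : ∀ i, b i ≠ 0)
    (h : ∀ a ∈ A, a ≠ 0 → ∃ i, poleOrder (b i) = poleOrder a) :
    A ≤ Submodule.span k (Set.range b) := by
  have key : ∀ n, ∀ a ∈ A, poleOrder a < n → a ∈ Submodule.span k (Set.range b) := by
    intro n
    induction n with
    | zero => intro a _ h; omega
    | succ n ih =>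
      intro a ha han
      by_cases ha0 : a = 0
      · rw [ha0]; exact zero_mem _
      obtain ⟨i, hi⟩ := h a ha ha0
      have hbi : b i ∈ Submodule.span k (Set.range b) := Submodule.subset_span ⟨i, rfl⟩
      obtain ⟨c, hc | hc⟩ := exists_poleOrder_sub_smul_lt (hb0 i) hi.symm
      · rw [hc]; exact Submodule.smul_mem _ _ hbi
      · rw [← sub_add_cancel a (c • b i)]
        exact add_mem (ih _ (sub_mem ha (Submodule.smul_mem _ _ (hbA i))) (by omega))
          (Submodule.smul_mem _ _ hbi)
  exact fun a ha => key _ a ha (Nat.lt_succ_self _)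

/-! ### The local ring at the origin and the spaces of sections -/

local notation "κ" => algebraMap k (FunField W)
local notation "ι" => algebraMap (CRing W) (FunField W)

theorem algebraMap_injective : Function.Injective (algebraMap (CRing W) (FunField W)) :=
  IsFractionRing.injective _ _

variable (W) in
/-- The value `F(x, y, 1)` of a form, as an element of the coordinate ring. -/
def evalCoord : MvPolynomial (Fin 3) k →ₐ[k] CRing W :=
  MvPolynomial.aeval ![xCoord W, yCoord W, 1]

theorem evalForm_eq (F : MvPolynomial (Fin 3) k) :
    evalForm W F = algebraMap (CRing W) (FunField W) (evalCoord W F) := by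
  have : evalForm W = (IsScalarTower.toAlgHom k (CRing W) (FunField W)).comp (evalCoord W) := by
    apply MvPolynomial.algHom_ext
    intro i
    fin_cases i <;> simp [evalForm, evalCoord, xFun, yFun, xCoord, yCoord]
  rw [this]
  rfl

theorem poleOrder_xCoord_pow_mul_yCoord_pow (i j : ℕ) :
    poleOrder (xCoord W ^ i * yCoord W ^ j) = 2 * i + 3 * j := by
  rw [poleOrder_mul (pow_ne_zero _ xCoord_ne_zero) (pow_ne_zero _ yCoord_ne_zero),
    poleOrder_pow, poleOrder_pow, poleOrder_xCoord, poleOrder_yCoord]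
  ring

theorem evalCoord_monomial (s : Fin 3 →₀ ℕ) (c : k) :
    evalCoord W (MvPolynomial.monomial s c) = c • (xCoord W ^ s 0 * yCoord W ^ s 1) := by
  rw [evalCoord, MvPolynomial.aeval_monomial, Finsupp.prod_fintype _ _ (by simp),
    Fin.prod_univ_three, Algebra.smul_def]
  simp

theorem poleOrder_evalCoord_le {d : ℕ} {F : MvPolynomial (Fin 3) k} (hF : F.IsHomogeneous d) :
    poleOrder (evalCoord W F) ≤ 3 * d := by
  rw [← mem_functionsOfPoleOrderLE, F.as_sum, map_sum]
  refine Submodule.sum_mem _ fun s hs => ?_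
  rw [evalCoord_monomial]
  refine Submodule.smul_mem _ _ ?_
  rw [mem_functionsOfPoleOrderLE, poleOrder_xCoord_pow_mul_yCoord_pow]
  have : s.degree = d := by
    rw [Finsupp.degree_eq_weight_one]; exact hF (MvPolynomial.mem_support_iff.1 hs)
  rw [Finsupp.degree_eq_sum, Fin.sum_univ_three] at this
  omega

/-- Among the monomials of degree `d` in `x, y, 1`, only `yᵈ` has a pole of order `3d`, and its
coefficient in `F` is the value of `F` at `[0 : 1 : 0]`. For `d = 0`, where `3 * d - 1` is `0`, the
difference vanishes. -/
theorem poleOrder_evalCoord_sub_le {d : ℕ} {F : MvPolynomial (Fin 3) k} (hF : F.IsHomogeneous d) :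
    poleOrder (evalCoord W F - MvPolynomial.eval ![0, 1, 0] F • yCoord W ^ d) ≤ 3 * d - 1 := by
  rw [← mem_functionsOfPoleOrderLE]
  conv => enter [2]; rw [F.as_sum]
  rw [map_sum, map_sum, Finset.sum_smul, ← Finset.sum_sub_distrib]
  refine Submodule.sum_mem _ fun s hs => ?_
  have hd : s.degree = d := by
    rw [Finsupp.degree_eq_weight_one]; exact hF (MvPolynomial.mem_support_iff.1 hs)
  rw [Finsupp.degree_eq_sum, Fin.sum_univ_three] at hd
  rw [evalCoord_monomial, MvPolynomial.eval_monomial, Finsupp.prod_fintype _ _ (by simp),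
    Fin.prod_univ_three, mul_smul, ← smul_sub]
  refine Submodule.smul_mem _ _ ?_
  by_cases h : s 0 = 0 ∧ s 2 = 0
  · have : s 1 = d := by omega
    simp [h.1, h.2, this]
  · have : ((0 : k) ^ s 0 * 1 ^ s 1 * 0 ^ s 2) = 0 := by
      by_cases h0 : s 0 = 0
      · have : s 2 ≠ 0 := fun h2 => h ⟨h0, h2⟩
        simp [this]
      · simp [h0]
    simp only [Matrix.cons_val_zero, Matrix.cons_val_one, Matrix.cons_val, this, zero_smul,
      sub_zero]
    rw [mem_functionsOfPoleOrderLE, poleOrder_xCoord_pow_mul_yCoord_pow]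
    omega

theorem poleOrder_evalCoord_eq {d : ℕ} {F : MvPolynomial (Fin 3) k} (hF : F.IsHomogeneous d)
    (h0 : MvPolynomial.eval ![0, 1, 0] F ≠ 0) : poleOrder (evalCoord W F) = 3 * d := by
  refine le_antisymm (poleOrder_evalCoord_le hF) ?_
  by_contra hlt
  have h1 : evalCoord W F ∈ functionsOfPoleOrderLE W (3 * d - 1) := by
    rw [mem_functionsOfPoleOrderLE]; omega
  have h2 := Submodule.sub_mem _ h1 (mem_functionsOfPoleOrderLE.2 (poleOrder_evalCoord_sub_le hF))
  rw [sub_sub_cancel, Submodule.smul_mem_iff _ h0, mem_functionsOfPoleOrderLE, poleOrder_pow,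
    poleOrder_yCoord] at h2
  omega

theorem eval_ne_zero_of_poleOrder {d : ℕ} {F : MvPolynomial (Fin 3) k} (hF : F.IsHomogeneous d)
    (hz : evalCoord W F ≠ 0) (h0 : poleOrder (evalCoord W F) = 3 * d) :
    MvPolynomial.eval ![0, 1, 0] F ≠ 0 := by
  intro h
  have := poleOrder_evalCoord_sub_le (W := W) hF
  rw [h, zero_smul, sub_zero] at this
  obtain rfl : d = 0 := by omega
  apply hz
  have hC := (MvPolynomial.totalDegree_eq_zero_iff_eq_C (p := F)).1
    (Nat.le_zero.1 hF.totalDegree_le)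
  rw [hC, MvPolynomial.eval_C] at h
  rw [hC, h, map_zero, map_zero]

/-- Every function with a pole of order at most `3d` is the value `F(x, y, 1)` of a form `F` of
degree `d`. -/
theorem exists_evalCoord_eq {d : ℕ} {a : CRing W} (ha : poleOrder a ≤ 3 * d) :
    ∃ F : MvPolynomial (Fin 3) k, F.IsHomogeneous d ∧ evalCoord W F = a := by
  -- the functions `xⁱyʲ` with `i ≤ 2` realise every pole order other than `1` exactly once
  let b : {ij : ℕ × ℕ // ij.1 ≤ 2 ∧ 2 * ij.1 + 3 * ij.2 ≤ 3 * d} → CRing W :=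
    fun ij => xCoord W ^ ij.1.1 * yCoord W ^ ij.1.2
  have hspan : functionsOfPoleOrderLE W (3 * d) ≤ Submodule.span k (Set.range b) := by
    apply le_span_range_of_poleOrder
    · rintro ⟨ij, h1, h2⟩
      rw [mem_functionsOfPoleOrderLE, poleOrder_xCoord_pow_mul_yCoord_pow]
      exact h2
    · intro i
      exact mul_ne_zero (pow_ne_zero _ xCoord_ne_zero) (pow_ne_zero _ yCoord_ne_zero)
    · intro a ha _
      rw [mem_functionsOfPoleOrderLE] at ha
      have h1 := poleOrder_ne_one a
      have : ∃ i j, i ≤ 2 ∧ 2 * i + 3 * j = poleOrder a := by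
        rcases (by omega : poleOrder a % 3 = 0 ∨ poleOrder a % 3 = 1 ∨ poleOrder a % 3 = 2)
          with h | h | h
        · exact ⟨0, poleOrder a / 3, by omega, by omega⟩
        · exact ⟨2, poleOrder a / 3 - 1, by omega, by omega⟩
        · exact ⟨1, poleOrder a / 3, by omega, by omega⟩
      obtain ⟨i, j, hi, hij⟩ := this
      exact ⟨⟨(i, j), hi, by simpa only [hij] using ha⟩, by
        rw [poleOrder_xCoord_pow_mul_yCoord_pow]; exact hij⟩
  have hmap : Submodule.span k (Set.range b) ≤
      (MvPolynomial.homogeneousSubmodule (Fin 3) k d).map (evalCoord W).toLinearMap := by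
    rw [Submodule.span_le]
    rintro _ ⟨⟨⟨i, j⟩, h1, h2⟩, rfl⟩
    simp only at h1 h2
    refine ⟨MvPolynomial.X 0 ^ i * MvPolynomial.X 1 ^ j * MvPolynomial.X 2 ^ (d - i - j), ?_, ?_⟩
    · have := ((MvPolynomial.isHomogeneous_X_pow (R := k) (0 : Fin 3) i).mul
        (MvPolynomial.isHomogeneous_X_pow (R := k) (1 : Fin 3) j)).mul
        (MvPolynomial.isHomogeneous_X_pow (R := k) (2 : Fin 3) (d - i - j))
      rwa [show i + j + (d - i - j) = d by omega] at this
    · simp [evalCoord, b]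
  obtain ⟨F, hF, rfl⟩ := hmap (hspan (mem_functionsOfPoleOrderLE.2 ha))
  exact ⟨F, hF, rfl⟩

/-- The local ring at the origin is the valuation ring of the pole order. -/
theorem div_mem_localRingAtZero {a b : CRing W} (hb : b ≠ 0) :
    algebraMap (CRing W) (FunField W) a / algebraMap (CRing W) (FunField W) b ∈
      localRingAtZero W ↔ poleOrder a ≤ poleOrder b := by
  have hinj := algebraMap_injective (W := W)
  constructor
  · rintro ⟨d, F, G, hF, hG, h0, h1, h⟩
    rw [evalForm_eq, evalForm_eq] at h
    rw [evalForm_eq, map_ne_zero_iff _ hinj] at h1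
    rw [div_eq_div_iff ((map_ne_zero_iff _ hinj).2 hb) ((map_ne_zero_iff _ hinj).2 h1),
      ← map_mul, ← map_mul] at h
    have h := hinj h
    by_cases ha : a = 0
    · simp [ha, poleOrder_zero]
    have hF0 : evalCoord W F ≠ 0 := by
      intro h'
      rw [h', zero_mul] at h
      exact mul_ne_zero ha h1 h
    have h := congrArg poleOrder h
    rw [poleOrder_mul ha h1, poleOrder_mul hF0 hb, poleOrder_evalCoord_eq hG h0] at h
    have := poleOrder_evalCoord_le (W := W) hF
    omega
  · intro h
    -- `a / b = (a b²) / b³`, and the pole order of `b³` is a multiple of `3`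
    have h3 : poleOrder (b ^ 3) = 3 * poleOrder b := poleOrder_pow _ _
    have h2 : poleOrder (a * b ^ 2) ≤ 3 * poleOrder b := by
      have := poleOrder_mul_le a (b ^ 2)
      rw [poleOrder_pow] at this
      omega
    obtain ⟨F, hF, hFa⟩ := exists_evalCoord_eq h2
    obtain ⟨G, hG, hGb⟩ := exists_evalCoord_eq h3.le
    refine ⟨_, F, G, hF, hG, ?_, ?_, ?_⟩
    · refine eval_ne_zero_of_poleOrder (W := W) hG ?_ ?_
      · rw [hGb]; exact pow_ne_zero _ hb
      · rw [hGb, h3]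
    · rw [evalForm_eq, hGb, map_ne_zero_iff _ hinj]
      exact pow_ne_zero _ hb
    · have hb' := (map_ne_zero_iff _ hinj).2 hb
      rw [evalForm_eq, evalForm_eq, hFa, hGb, map_mul, map_pow, map_pow]
      field_simp

theorem algebraMap_mem_localRingAtZero {a : CRing W} :
    algebraMap (CRing W) (FunField W) a ∈ localRingAtZero W ↔ poleOrder a = 0 := by
  simpa [poleOrder_one] using div_mem_localRingAtZero (W := W) (a := a) one_ne_zero

theorem mem_nonunits_localRingAtZero {t : localRingAtZero W} :
    t ∈ nonunits (localRingAtZero W) ↔ (t : FunField W) = 0 ∨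
      (t : FunField W)⁻¹ ∉ localRingAtZero W := by
  rw [mem_nonunits_iff, ← not_iff_not, not_not, not_or, not_not]
  constructor
  · rintro ⟨u, rfl⟩
    have h : ((u : localRingAtZero W) : FunField W) *
        ((u⁻¹ : (localRingAtZero W)ˣ) : localRingAtZero W) = 1 := by
      rw [← MulMemClass.coe_mul, u.mul_inv]; rfl
    refine ⟨left_ne_zero_of_mul_eq_one h, ?_⟩
    rw [inv_eq_of_mul_eq_one_right h]
    exact SetLike.coe_mem _
  · rintro ⟨h0, h⟩
    exact IsUnit.of_mul_eq_one ⟨_, h⟩ (Subtype.ext (mul_inv_cancel₀ h0))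

theorem mem_regularAwayFromZero {f : FunField W} :
    f ∈ regularAwayFromZero W ↔ ∃ a : CRing W, algebraMap (CRing W) (FunField W) a = f := by
  rw [regularAwayFromZero]
  exact AlgHom.mem_range _

theorem mem_sections {f : FunField W} {n : ℕ} :
    f ∈ sections W n ↔
      ∃ a : CRing W, algebraMap (CRing W) (FunField W) a = f ∧ poleOrder a ≤ n := by
  have hinj := algebraMap_injective (W := W)
  change f ∈ regularAwayFromZero W ∧ (∀ t ∈ nonunits (localRingAtZero W),
    f * (t : FunField W) ^ n ∈ localRingAtZero W) ↔ _
  rw [mem_regularAwayFromZero]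
  constructor
  · rintro ⟨⟨a, rfl⟩, h⟩
    refine ⟨a, rfl, ?_⟩
    -- `x / y` is a local parameter at the origin
    have hmem := (div_mem_localRingAtZero (W := W) (a := xCoord W) yCoord_ne_zero).2
      (by rw [poleOrder_xCoord, poleOrder_yCoord]; norm_num)
    have := h ⟨_, hmem⟩ (by
      rw [mem_nonunits_localRingAtZero]
      right
      rw [inv_div, div_mem_localRingAtZero xCoord_ne_zero, poleOrder_xCoord, poleOrder_yCoord]
      norm_num)
    simp only [div_pow, ← map_pow] at this
    rw [← mul_div_assoc, ← map_mul, div_mem_localRingAtZero (pow_ne_zero _ yCoord_ne_zero),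
      poleOrder_pow, poleOrder_yCoord] at this
    by_cases ha : a = 0
    · simp [ha, poleOrder_zero]
    rw [poleOrder_mul ha (pow_ne_zero _ xCoord_ne_zero), poleOrder_pow, poleOrder_xCoord] at this
    omega
  · rintro ⟨a, rfl, ha⟩
    refine ⟨⟨a, rfl⟩, ?_⟩
    rintro ⟨t, ht⟩ htn
    obtain ⟨b, c, hc, rfl⟩ := IsFractionRing.div_surjective (A := CRing W) t
    have hc := nonZeroDivisors.ne_zero hc
    rw [mem_nonunits_localRingAtZero] at htn
    simp only at htn ⊢
    by_cases hb : b = 0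
    · simp only [hb, map_zero, zero_div]
      rcases Nat.eq_zero_or_pos n with rfl | hn
      · rw [pow_zero, mul_one, algebraMap_mem_localRingAtZero]
        omega
      · rw [zero_pow hn.ne', mul_zero]
        exact zero_mem _
    have hbc : poleOrder b < poleOrder c := by
      by_contra hle
      refine htn.elim (fun h => ?_) (fun h => h ?_)
      · exact (div_ne_zero ((map_ne_zero_iff _ hinj).2 hb) ((map_ne_zero_iff _ hinj).2 hc)) h
      · rw [inv_div, div_mem_localRingAtZero hb]; omega
    rw [div_pow, ← map_pow, ← map_pow, ← mul_div_assoc, ← map_mul,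
      div_mem_localRingAtZero (pow_ne_zero _ hc), poleOrder_pow]
    refine (poleOrder_mul_le _ _).trans ?_
    rw [poleOrder_pow]
    calc poleOrder a + n * poleOrder b ≤ n + n * poleOrder b := by omega
      _ = n * (poleOrder b + 1) := by ring
      _ ≤ n * poleOrder c := Nat.mul_le_mul_left _ hbc

theorem map_mem_sections {σ : FunField W ≃ₐ[k] FunField W} (hσ : σ ∈ originAut W)
    {f : FunField W} {n : ℕ} (hf : f ∈ sections W n) : σ f ∈ sections W n := by
  refine ⟨(hσ.2 f).2 hf.1, fun t ht => ?_⟩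
  have hmem : σ.symm t ∈ localRingAtZero W := by
    rw [← hσ.1, σ.apply_symm_apply]; exact t.2
  have := hf.2 ⟨_, hmem⟩ (by
    rw [mem_nonunits_localRingAtZero] at ht ⊢
    simp only [← map_inv₀]
    rw [EmbeddingLike.map_eq_zero_iff, ← hσ.1, σ.apply_symm_apply]
    exact ht)
  rw [← hσ.1, map_mul, map_pow, σ.apply_symm_apply] at this
  exact this

/-! ### Automorphisms as changes of variables -/

theorem algebraMap_aeval_xCoord (p : k[X]) :
    algebraMap (CRing W) (FunField W) (aeval (xCoord W) p) = aeval (xFun W) p := by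
  rw [← aeval_algebraMap_apply]
  rfl

theorem algebraMap_aeval_add (p q : k[X]) :
    algebraMap (CRing W) (FunField W) (aeval (xCoord W) p + aeval (xCoord W) q * yCoord W) =
      aeval (xFun W) p + aeval (xFun W) q * yFun W := by
  rw [map_add, map_mul, algebraMap_aeval_xCoord, algebraMap_aeval_xCoord]
  rfl

theorem aeval_xFun_add_eq_zero {p q : k[X]}
    (h : aeval (xFun W) p + aeval (xFun W) q * yFun W = 0) : p = 0 ∧ q = 0 := by
  rw [← algebraMap_aeval_add] at h
  exact aeval_add_eq_zero (algebraMap_injective (by rw [h, map_zero]))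

theorem yFun_sq : yFun W ^ 2 = xFun W ^ 3 + κ W.a₂ * xFun W ^ 2 + κ W.a₄ * xFun W + κ W.a₆ -
    (κ W.a₁ * xFun W + κ W.a₃) * yFun W := by
  have h := CoordinateRing.smul_basis_mul_Y (W' := W.toAffine) 0 1
  have h1 := smul_one_add_smul_yCoord (W := W) 0 1
  have h2 := smul_one_add_smul_yCoord (W := W)
    (1 * (X ^ 3 + C W.a₂ * X ^ 2 + C W.a₄ * X + C W.a₆)) (0 - 1 * (C W.a₁ * X + C W.a₃))
  unfold yCoord at h1 h2
  erw [h1, h2] at h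
  have h := congrArg (algebraMap (CRing W) (FunField W)) h
  rw [map_mul] at h
  erw [algebraMap_aeval_add, algebraMap_aeval_add] at h
  simp only [map_zero, map_one, zero_add, one_mul, zero_sub, map_add, map_mul, map_neg, map_pow,
    aeval_X, aeval_C] at h
  change yFun W * yFun W = _ at h
  linear_combination h

/-- Linear independence of `1, x, x², x³, y, xy`. -/
theorem coeffs_eq_zero {c₀ c₁ c₂ c₃ d₀ d₁ : k}
    (h : κ c₀ + κ c₁ * xFun W + κ c₂ * xFun W ^ 2 + κ c₃ * xFun W ^ 3 +
      (κ d₀ + κ d₁ * xFun W) * yFun W = 0) :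
    c₀ = 0 ∧ c₁ = 0 ∧ c₂ = 0 ∧ c₃ = 0 ∧ d₀ = 0 ∧ d₁ = 0 := by
  have := aeval_xFun_add_eq_zero (W := W) (p := C c₀ + C c₁ * X + C c₂ * X ^ 2 + C c₃ * X ^ 3)
    (q := C d₀ + C d₁ * X) (by simpa using h)
  have hp := fun i => congrArg (fun r => coeff r i) this.1
  have hq := fun i => congrArg (fun r => coeff r i) this.2
  refine ⟨?_, ?_, ?_, ?_, ?_, ?_⟩
  · simpa using hp 0
  · simpa [coeff_X, coeff_C] using hp 1
  · simpa [coeff_X, coeff_C, coeff_X_pow] using hp 2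
  · simpa [coeff_X, coeff_C, coeff_X_pow] using hp 3
  · simpa using hq 0
  · simpa [coeff_X, coeff_C] using hq 1

/-- The automorphism `σ` of the function field is given by the change of variables `D`, that is, by
`x ↦ u²x + r` and `y ↦ u³y + u²sx + t`. -/
structure IsSubstitution (σ : FunField W ≃ₐ[k] FunField W)
    (D : WeierstrassCurve.VariableChange k) : Prop where
  map_x : σ (xFun W) = κ D.u ^ 2 * xFun W + κ D.r
  map_y : σ (yFun W) = κ D.u ^ 3 * yFun W + κ D.u ^ 2 * κ D.s * xFun W + κ D.t

theorem xFun_mem_sections : xFun W ∈ sections W 2 :=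
  mem_sections.2 ⟨xCoord W, rfl, poleOrder_xCoord.le⟩

theorem yFun_mem_sections : yFun W ∈ sections W 3 :=
  mem_sections.2 ⟨yCoord W, rfl, poleOrder_yCoord.le⟩

theorem exists_of_mem_sections_three {f : FunField W} (hf : f ∈ sections W 3) :
    ∃ b s t : k, f = κ b * yFun W + κ s * xFun W + κ t := by
  obtain ⟨a, rfl, ha⟩ := mem_sections.1 hf
  obtain ⟨p, q, rfl⟩ := exists_eq_aeval_add a
  rw [poleOrder_le_iff] at ha
  obtain ⟨t, s, rfl⟩ : ∃ t s, p = C t + C s * X := by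
    refine ⟨p.coeff 0, p.coeff 1, ?_⟩
    conv_lhs => rw [eq_X_add_C_of_natDegree_le_one (p := p) (by omega)]
    ring
  obtain ⟨b, rfl⟩ : ∃ b, q = C b := by
    rcases ha.2 with rfl | h
    · exact ⟨0, by simp⟩
    · exact ⟨_, eq_C_of_natDegree_eq_zero (by omega)⟩
  refine ⟨b, s, t, ?_⟩
  rw [algebraMap_aeval_add]
  simp only [map_add, map_mul, aeval_X, aeval_C]
  ring

theorem exists_of_mem_sections_two {f : FunField W} (hf : f ∈ sections W 2) :
    ∃ s t : k, f = κ s * xFun W + κ t := by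
  obtain ⟨a, rfl, ha⟩ := mem_sections.1 hf
  obtain ⟨p, q, rfl⟩ := exists_eq_aeval_add a
  rw [poleOrder_le_iff] at ha
  obtain rfl : q = 0 := ha.2.resolve_right (by omega)
  refine ⟨p.coeff 1, p.coeff 0, ?_⟩
  rw [algebraMap_aeval_add, eq_X_add_C_of_natDegree_le_one (p := p) (by omega)]
  simp

theorem exists_isSubstitution {σ : FunField W ≃ₐ[k] FunField W} (hσ : σ ∈ originAut W) :
    ∃ D : WeierstrassCurve.VariableChange k, IsSubstitution σ D := by
  obtain ⟨α, r, hx⟩ := exists_of_mem_sections_two (map_mem_sections hσ xFun_mem_sections)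
  obtain ⟨β, s, t, hy⟩ := exists_of_mem_sections_three (map_mem_sections hσ yFun_mem_sections)
  have hα : α ≠ 0 := by
    rintro rfl
    have : σ (xFun W - κ r) = 0 := by
      rw [map_sub, hx, AlgEquiv.commutes, map_zero]; ring
    rw [EmbeddingLike.map_eq_zero_iff] at this
    have := coeffs_eq_zero (W := W) (c₀ := -r) (c₁ := 1) (c₂ := 0) (c₃ := 0) (d₀ := 0) (d₁ := 0)
      (by simp only [map_zero, map_one, map_neg]; linear_combination this)
    exact one_ne_zero this.2.1
  have h1 : β ^ 2 - α ^ 3 = 0 := by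
    have h := congrArg σ (yFun_sq (W := W))
    simp only [map_add, map_mul, map_pow, map_sub, hx, hy, AlgEquiv.commutes] at h
    refine (coeffs_eq_zero (W := W)
      (c₀ := β ^ 2 * W.a₆ + t ^ 2 + W.a₁ * r * t + W.a₃ * t - r ^ 3 - W.a₂ * r ^ 2 - W.a₄ * r
        - W.a₆)
      (c₁ := β ^ 2 * W.a₄ + 2 * s * t + W.a₁ * (α * t + r * s) + W.a₃ * s - 3 * α * r ^ 2
        - 2 * W.a₂ * α * r - W.a₄ * α)
      (c₂ := β ^ 2 * W.a₂ + s ^ 2 + W.a₁ * α * s - 3 * α ^ 2 * r - W.a₂ * α ^ 2)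
      (d₀ := - β ^ 2 * W.a₃ + 2 * β * t + W.a₁ * r * β + W.a₃ * β)
      (d₁ := - β ^ 2 * W.a₁ + 2 * β * s + W.a₁ * α * β) ?_).2.2.2.1
    simp only [map_add, map_mul, map_pow, map_sub, map_neg, map_ofNat]
    linear_combination h - κ β ^ 2 * yFun_sq (W := W)
  have hβ : β ≠ 0 := by
    rintro rfl
    exact hα (by simpa using h1)
  have hu2 : (β / α) ^ 2 = α := by
    field_simp; linear_combination h1
  have hu3 : (β / α) ^ 3 = β := by
    rw [pow_succ, hu2]; field_simp
  refine ⟨⟨Units.mk0 (β / α) (div_ne_zero hβ hα), r, s / α, t⟩, ?_, ?_⟩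
  · simp only [Units.val_mk0]
    rw [← map_pow, hu2, hx]
  · simp only [Units.val_mk0]
    rw [← map_pow, ← map_pow, hu2, hu3, hy, ← map_mul, mul_div_cancel₀ _ hα]

/-- Applying `σ` to the Weierstrass equation and comparing coefficients. -/
theorem IsSubstitution.smul_eq {σ : FunField W ≃ₐ[k] FunField W}
    {D : WeierstrassCurve.VariableChange k} (hD : IsSubstitution σ D) : D • W = W := by
  have h := congrArg σ (yFun_sq (W := W))
  simp only [map_add, map_mul, map_pow, map_sub, hD.map_x, hD.map_y, AlgEquiv.commutes] at h
  obtain ⟨v, hv⟩ : ∃ v : k, (D.u : k) * v = 1 := ⟨_, D.u.mul_inv⟩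
  have hv' : ((D.u⁻¹ : kˣ) : k) = v := by
    rw [Units.val_inv_eq_inv_val, inv_eq_of_mul_eq_one_right hv]
  obtain ⟨h0, h1, h2, -, h4, h5⟩ := coeffs_eq_zero (W := W)
    (c₀ := D.u ^ 6 * W.a₆ + D.t ^ 2 + W.a₁ * D.r * D.t + W.a₃ * D.t - D.r ^ 3 - W.a₂ * D.r ^ 2
      - W.a₄ * D.r - W.a₆)
    (c₁ := D.u ^ 2 * (D.u ^ 4 * W.a₄ + 2 * D.s * D.t + W.a₁ * (D.t + D.r * D.s) + W.a₃ * D.s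
      - 3 * D.r ^ 2 - 2 * W.a₂ * D.r - W.a₄))
    (c₂ := D.u ^ 4 * (D.u ^ 2 * W.a₂ + D.s ^ 2 + W.a₁ * D.s - 3 * D.r - W.a₂))
    (c₃ := 0)
    (d₀ := D.u ^ 3 * (- D.u ^ 3 * W.a₃ + 2 * D.t + W.a₁ * D.r + W.a₃))
    (d₁ := D.u ^ 5 * (- D.u * W.a₁ + 2 * D.s + W.a₁)) (by
      simp only [map_add, map_mul, map_pow, map_sub, map_neg, map_ofNat, map_zero]
      linear_combination h - κ D.u ^ 6 * yFun_sq (W := W))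
  have hu : (D.u : k) ≠ 0 := D.u.ne_zero
  replace h1 := (mul_eq_zero.1 h1).resolve_left (pow_ne_zero _ hu)
  replace h2 := (mul_eq_zero.1 h2).resolve_left (pow_ne_zero _ hu)
  replace h4 := (mul_eq_zero.1 h4).resolve_left (pow_ne_zero _ hu)
  replace h5 := (mul_eq_zero.1 h5).resolve_left (pow_ne_zero _ hu)
  ext
  · rw [WeierstrassCurve.variableChange_a₁, hv']
    linear_combination v * h5 + W.a₁ * hv
  · rw [WeierstrassCurve.variableChange_a₂, hv']
    linear_combination -v ^ 2 * h2 + W.a₂ * (v * D.u + 1) * hv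
  · rw [WeierstrassCurve.variableChange_a₃, hv']
    have : (D.u : k) ^ 3 * v ^ 3 = 1 := by rw [← mul_pow, hv, one_pow]
    linear_combination v ^ 3 * h4 + W.a₃ * this
  · rw [WeierstrassCurve.variableChange_a₄, hv']
    have : (D.u : k) ^ 4 * v ^ 4 = 1 := by rw [← mul_pow, hv, one_pow]
    linear_combination -v ^ 4 * h1 + W.a₄ * this
  · rw [WeierstrassCurve.variableChange_a₆, hv']
    have : (D.u : k) ^ 6 * v ^ 6 = 1 := by rw [← mul_pow, hv, one_pow]
    linear_combination -v ^ 6 * h0 + W.a₆ * this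

theorem algEquiv_ext {σ τ : FunField W ≃ₐ[k] FunField W} (hx : σ (xFun W) = τ (xFun W))
    (hy : σ (yFun W) = τ (yFun W)) : σ = τ := by
  ext f
  obtain ⟨a, b, -, rfl⟩ := IsFractionRing.div_surjective (A := CRing W) f
  have key : ∀ a : CRing W, σ (algebraMap _ _ a) = τ (algebraMap _ _ a) := by
    intro a
    obtain ⟨p, q, rfl⟩ := exists_eq_aeval_add a
    rw [algebraMap_aeval_add]
    simp only [map_add, map_mul, ← aeval_algHom_apply, hx, hy]
  rw [map_div₀, map_div₀, key, key]

theorem IsSubstitution.ext {σ τ : FunField W ≃ₐ[k] FunField W}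
    {D : WeierstrassCurve.VariableChange k} (h : IsSubstitution σ D) (h' : IsSubstitution τ D) :
    σ = τ :=
  algEquiv_ext (by rw [h.map_x, h'.map_x]) (by rw [h.map_y, h'.map_y])

/-- The transformation formulas for the coefficients of the Weierstrass equation, the quantities `bᵢ`
and the discriminant, under a change of variables that fixes the equation. -/
theorem relations_of_smul_eq {D : WeierstrassCurve.VariableChange k} (h : D • W = W) :
    D.u ^ 1 * W.a₁ = W.a₁ + 2 * D.s ∧
    D.u ^ 3 * W.a₃ = W.a₃ + D.r * W.a₁ + 2 * D.t ∧
    D.u ^ 2 * W.a₂ = W.a₂ - D.s * W.a₁ + 3 * D.r - D.s ^ 2 ∧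
    D.u ^ 6 * W.a₆ = W.a₆ + D.r * W.a₄ + D.r ^ 2 * W.a₂ + D.r ^ 3 - D.t * W.a₃ - D.t ^ 2
      - D.r * D.t * W.a₁ ∧
    D.u ^ 2 * W.b₂ = W.b₂ + 12 * D.r ∧
    D.u ^ 6 * W.b₆ = W.b₆ + 2 * D.r * W.b₄ + D.r ^ 2 * W.b₂ + 4 * D.r ^ 3 ∧
    D.u ^ 8 * W.b₈ = W.b₈ + 3 * D.r * W.b₆ + 3 * D.r ^ 2 * W.b₄ + D.r ^ 3 * W.b₂ + 3 * D.r ^ 4 ∧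
    D.u ^ 12 * W.Δ = W.Δ := by
  have key : ∀ (n : ℕ) (c e : k), e = ((D.u⁻¹ : kˣ) : k) ^ n * c → (D.u : k) ^ n * e = c := by
    rintro n c _ rfl
    rw [← mul_assoc, ← mul_pow, D.u.mul_inv, one_pow, one_mul]
  refine ⟨key 1 _ _ ?_, key 3 _ _ ?_, key 2 _ _ ?_, key 6 _ _ ?_, key 2 _ _ ?_,
    key 6 _ _ ?_, key 8 _ _ ?_, key 12 _ _ ?_⟩
  · rw [pow_one, ← WeierstrassCurve.variableChange_a₁, h]
  · rw [← WeierstrassCurve.variableChange_a₃, h]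
  · rw [← WeierstrassCurve.variableChange_a₂, h]
  · rw [← WeierstrassCurve.variableChange_a₆, h]
  · rw [← WeierstrassCurve.variableChange_b₂, h]
  · rw [← WeierstrassCurve.variableChange_b₆, h]
  · rw [← WeierstrassCurve.variableChange_b₈, h]
  · rw [← WeierstrassCurve.variableChange_Δ, h]

/-- This is where the discriminant has to be nonzero. -/
theorem u_pow_twelve [W.IsElliptic] {D : WeierstrassCurve.VariableChange k} (h : D • W = W) :
    (D.u : k) ^ 12 = 1 :=
  mul_right_cancel₀ W.isUnit_Δ.ne_zero (by
    rw [one_mul]; exact (relations_of_smul_eq h).2.2.2.2.2.2.2)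

/-- There are finitely many `u`, as `u¹² = 1`. For given `u`, the formula for `b₆`, or the one for
`b₈` in characteristic two, is a nontrivial equation for `r`; then the formulas for `a₂` and `a₆` are
monic quadratic equations for `s` and `t`. -/
theorem finite_smul_eq_self [W.IsElliptic] :
    {D : WeierstrassCurve.VariableChange k | D • W = W}.Finite := by
  classical
  have h43 : (4 : k) ≠ 0 ∨ (3 : k) ≠ 0 := by
    by_contra! h
    exact one_ne_zero (α := k) (by linear_combination h.1 - h.2)
  have hroot : ∀ {p : k[X]} {n : ℕ} {a x : k}, p.coeff n = a → a ≠ 0 → p.eval x = 0 →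
      x ∈ p.roots.toFinset := by
    intro p n a x hpn ha hx
    rw [Multiset.mem_toFinset, mem_roots (fun h0 => ha (by rw [← hpn, h0, coeff_zero]))]
    exact hx
  let pu : k[X] := C 1 * X ^ 12 + C (-1)
  let pr : k → k[X] := fun u => C 4 * X ^ 3 + C W.b₂ * X ^ 2 + C (2 * W.b₄) * X +
    C (W.b₆ - u ^ 6 * W.b₆)
  let pr' : k → k[X] := fun u => C 3 * X ^ 4 + C W.b₂ * X ^ 3 + C (3 * W.b₄) * X ^ 2 +
    C (3 * W.b₆) * X + C (W.b₈ - u ^ 8 * W.b₈)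
  let ps : k → k → k[X] := fun u r => C 1 * X ^ 2 + C W.a₁ * X +
    C (u ^ 2 * W.a₂ - W.a₂ - 3 * r)
  let pt : k → k → k[X] := fun u r => C 1 * X ^ 2 + C (W.a₃ + r * W.a₁) * X +
    C (u ^ 6 * W.a₆ - (W.a₆ + r * W.a₄ + r ^ 2 * W.a₂ + r ^ 3))
  let T : Finset (k × k × k × k) := pu.roots.toFinset.biUnion fun u =>
    ((pr u).roots.toFinset ∪ (pr' u).roots.toFinset).biUnion fun r =>
      (ps u r).roots.toFinset.biUnion fun s => (pt u r).roots.toFinset.image fun t => (u, r, s, t)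
  refine Set.Finite.of_finite_image (f := fun D => ((D.u : k), D.r, D.s, D.t))
    (T.finite_toSet.subset ?_) ?_
  · rintro _ ⟨D, hD, rfl⟩
    obtain ⟨-, -, h2, h6, -, hb6, hb8, -⟩ := relations_of_smul_eq hD
    have h12 := u_pow_twelve hD
    simp only [T, Finset.mem_coe, Finset.mem_biUnion, Finset.mem_image]
    refine ⟨D.u, ?_, D.r, ?_, D.s, ?_, D.t, ?_, rfl⟩
    · refine hroot (n := 12) (a := 1) (by
        simp only [pu, coeff_add, coeff_C_mul, coeff_X_pow, coeff_C]
        norm_num) one_ne_zero ?_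
      simp only [pu, eval_add, eval_mul, eval_C, eval_pow, eval_X]
      linear_combination h12
    · rw [Finset.mem_union]
      refine h43.imp (fun h4 => ?_) (fun h3 => ?_)
      · refine hroot (n := 3) (a := 4) (by
          simp only [pr, coeff_add, coeff_C_mul, coeff_X_pow, coeff_X, coeff_C]
          norm_num) h4 ?_
        simp only [pr, eval_add, eval_mul, eval_C, eval_pow, eval_X]
        linear_combination -hb6
      · refine hroot (n := 4) (a := 3) (by
          simp only [pr', coeff_add, coeff_C_mul, coeff_X_pow, coeff_X, coeff_C]
          norm_num) h3 ?_
        simp only [pr', eval_add, eval_mul, eval_C, eval_pow, eval_X]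
        linear_combination -hb8
    · refine hroot (n := 2) (a := 1) (by
        simp only [ps, coeff_add, coeff_C_mul, coeff_X_pow, coeff_X, coeff_C]
        norm_num) one_ne_zero ?_
      simp only [ps, eval_add, eval_mul, eval_C, eval_pow, eval_X]
      linear_combination h2
    · refine hroot (n := 2) (a := 1) (by
        simp only [pt, coeff_add, coeff_C_mul, coeff_X_pow, coeff_X, coeff_C]
        norm_num) one_ne_zero ?_
      simp only [pt, eval_add, eval_mul, eval_C, eval_pow, eval_X]
      linear_combination h6
  · intro D _ D' _ h
    simp only [Prod.mk.injEq] at h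
    exact WeierstrassCurve.VariableChange.ext (Units.ext h.1) h.2.1 h.2.2.1 h.2.2.2

/-! ### The homomorphism to changes of variables, and invariants of pole order three -/

theorem IsSubstitution.mul {σ τ : FunField W ≃ₐ[k] FunField W}
    {D D' : WeierstrassCurve.VariableChange k} (h : IsSubstitution σ D) (h' : IsSubstitution τ D') :
    IsSubstitution (σ * τ) (D * D') := by
  constructor
  · rw [AlgEquiv.mul_apply, h'.map_x, WeierstrassCurve.VariableChange.mul_def]
    simp only [map_add, map_mul, map_pow, AlgEquiv.commutes, h.map_x, Units.val_mul]
    ring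
  · rw [AlgEquiv.mul_apply, h'.map_y, WeierstrassCurve.VariableChange.mul_def]
    simp only [map_add, map_mul, map_pow, AlgEquiv.commutes, h.map_x, h.map_y, Units.val_mul]
    ring

theorem IsSubstitution.unique {σ : FunField W ≃ₐ[k] FunField W}
    {D D' : WeierstrassCurve.VariableChange k} (h : IsSubstitution σ D)
    (h' : IsSubstitution σ D') : D = D' := by
  obtain ⟨hr, hu2, -⟩ := coeffs_eq_zero (W := W) (c₀ := D.r - D'.r) (c₁ := D.u ^ 2 - D'.u ^ 2)
    (c₂ := 0) (c₃ := 0) (d₀ := 0) (d₁ := 0) (by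
      simp only [map_sub, map_pow, map_zero]
      linear_combination h'.map_x - h.map_x)
  obtain ⟨ht, hs, -, -, hu3, -⟩ := coeffs_eq_zero (W := W) (c₀ := D.t - D'.t)
    (c₁ := D.u ^ 2 * D.s - D'.u ^ 2 * D'.s) (c₂ := 0) (c₃ := 0) (d₀ := D.u ^ 3 - D'.u ^ 3)
    (d₁ := 0) (by
      simp only [map_sub, map_mul, map_pow, map_zero]
      linear_combination h'.map_y - h.map_y)
  have hu' : (D'.u : k) ^ 2 ≠ 0 := pow_ne_zero _ D'.u.ne_zero
  have hu : (D.u : k) = D'.u :=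
    mul_left_cancel₀ hu' (by linear_combination hu3 - (D.u : k) * hu2)
  refine WeierstrassCurve.VariableChange.ext (Units.ext hu) (sub_eq_zero.1 hr) ?_
    (sub_eq_zero.1 ht)
  rw [hu] at hs
  exact mul_left_cancel₀ hu' (sub_eq_zero.1 hs)

variable (W) in
/-- The change of variables that describes an automorphism fixing the origin. In
`VariableChange k` the product `D * D'` is `D'` with `D` substituted into it, so this is a
homomorphism and not an antihomomorphism. -/
def substitution : originAut W →* WeierstrassCurve.VariableChange k :=
  MonoidHom.mk' (fun σ => (exists_isSubstitution σ.2).choose) fun σ τ =>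
    (exists_isSubstitution (σ * τ).2).choose_spec.unique
      ((exists_isSubstitution σ.2).choose_spec.mul (exists_isSubstitution τ.2).choose_spec)

theorem isSubstitution (σ : originAut W) : IsSubstitution σ.1 (substitution W σ) :=
  (exists_isSubstitution σ.2).choose_spec

theorem smul_eq_self (σ : originAut W) : substitution W σ • W = W :=
  (isSubstitution σ).smul_eq

theorem substitution_injective : Function.Injective (substitution W) := fun σ τ h =>
  Subtype.ext ((isSubstitution σ).ext (h ▸ isSubstitution τ))

theorem finite_originAut [W.IsElliptic] : Finite (originAut W) := by
  have : Finite {D : WeierstrassCurve.VariableChange k // D • W = W} := finite_smul_eq_self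
  exact Finite.of_injective
    (fun σ => (⟨_, smul_eq_self σ⟩ : {D : WeierstrassCurve.VariableChange k // D • W = W}))
    fun σ τ h => substitution_injective (congrArg Subtype.val h)

theorem apply_xFun_eq_self {σ : originAut W} (hu : ((substitution W σ).u : k) ^ 2 = 1)
    (hr : (substitution W σ).r = 0) : σ.1 (xFun W) = xFun W := by
  rw [(isSubstitution σ).map_x, ← map_pow, hu, hr, map_one, map_zero, one_mul, add_zero]

theorem u_one : ((substitution W 1).u : k) = 1 := by
  rw [map_one]; rfl

theorem u_mul (σ τ : originAut W) :
    ((substitution W (σ * τ)).u : k) = (substitution W σ).u * (substitution W τ).u := by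
  rw [map_mul]; rfl

theorem u_pow (σ : originAut W) (n : ℕ) :
    ((substitution W (σ ^ n)).u : k) = ((substitution W σ).u : k) ^ n := by
  induction n with
  | zero => rw [pow_zero, pow_zero, u_one]
  | succ n ih => rw [pow_succ, u_mul, ih, pow_succ]

theorem r_mul (σ τ : originAut W) : (substitution W (σ * τ)).r =
    (substitution W σ).r * (substitution W τ).u ^ 2 + (substitution W τ).r := by
  rw [map_mul]; rfl

/-- If `τ ∈ G` has `u² = 1`, the formula for `b₂` gives `12r = 0`, so `3r = 0`; then `τ³` fixes `x`,
so that `τ³ = 1` and `u = 1`. With `u¹² = 1` for `σ`, this applies to `σ⁶` and then to `σ³`. -/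
theorem u_pow_three_eq_one_of_two_ne_zero [W.IsElliptic] (G : Subgroup (originAut W))
    (hG : ∀ σ ∈ G, σ.1 (xFun W) = xFun W → σ = 1) (h2 : (2 : k) ≠ 0) {σ : originAut W}
    (hσ : σ ∈ G) : ((substitution W σ).u : k) ^ 3 = 1 := by
  have key : ∀ τ ∈ G, ((substitution W τ).u : k) ^ 2 = 1 → ((substitution W τ).u : k) = 1 := by
    intro τ hτ hu
    have hb2 := (relations_of_smul_eq (smul_eq_self τ)).2.2.2.2.1
    have h3r : 3 * (substitution W τ).r = 0 := by
      have : (2 : k) ^ 2 * (3 * (substitution W τ).r) = 0 := by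
        linear_combination W.b₂ * hu - hb2
      exact (mul_eq_zero.1 this).resolve_left (pow_ne_zero _ h2)
    have h1 : τ ^ 3 = 1 := by
      apply hG _ (pow_mem hτ 3)
      apply apply_xFun_eq_self
      · rw [u_pow]
        linear_combination (((substitution W τ).u : k) ^ 4 + (substitution W τ).u ^ 2 + 1) * hu
      · rw [pow_succ, pow_two, r_mul, r_mul]
        linear_combination ((substitution W τ).u ^ 2 + 2) * (substitution W τ).r * hu + h3r
    have h3 : ((substitution W τ).u : k) ^ 3 = 1 := by rw [← u_pow, h1, u_one]
    linear_combination h3 - ((substitution W τ).u : k) * hu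
  have h12 := u_pow_twelve (smul_eq_self σ)
  have h6 := key (σ ^ 6) (pow_mem hσ 6) (by rw [u_pow, ← pow_mul]; exact h12)
  rw [u_pow] at h6
  have h3 := key (σ ^ 3) (pow_mem hσ 3) (by rw [u_pow, ← pow_mul]; exact h6)
  rwa [u_pow] at h3

/-- In characteristic two, `σ²` fixes `x` if `u = 1`, so it is trivial and `rs = 0`; the formula for
`a₂` then gives `r = 0` in any case, and `σ` fixes `x`. -/
theorem eq_one_of_u_eq_one_of_two_eq_zero (G : Subgroup (originAut W))
    (hG : ∀ σ ∈ G, σ.1 (xFun W) = xFun W → σ = 1) (h2 : (2 : k) = 0) {σ : originAut W}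
    (hσ : σ ∈ G) (hu : ((substitution W σ).u : k) = 1) : σ = 1 := by
  have h1 : σ * σ = 1 := by
    apply hG _ (mul_mem hσ hσ)
    apply apply_xFun_eq_self
    · rw [u_mul, hu]; norm_num
    · rw [r_mul, hu]; linear_combination (substitution W σ).r * h2
  have ht : (substitution W σ).r * (substitution W σ).s = 0 := by
    have := congrArg WeierstrassCurve.VariableChange.t (congrArg (substitution W) h1)
    rw [map_mul, map_one, WeierstrassCurve.VariableChange.mul_def,
      WeierstrassCurve.VariableChange.one_def] at this
    simp only [hu] at this
    linear_combination this - (substitution W σ).t * h2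
  have ha2 := (relations_of_smul_eq (smul_eq_self σ)).2.2.1
  rw [hu] at ha2
  refine hG _ hσ (apply_xFun_eq_self (by rw [hu, one_pow]) ?_)
  rcases mul_eq_zero.1 ht with h | h
  · exact h
  · rw [h] at ha2
    linear_combination -ha2 - (substitution W σ).r * h2

theorem u_pow_three_eq_one [W.IsElliptic] (G : Subgroup (originAut W))
    (hG : ∀ σ ∈ G, σ.1 (xFun W) = xFun W → σ = 1) {σ : originAut W}
    (hσ : σ ∈ G) : ((substitution W σ).u : k) ^ 3 = 1 := by
  by_cases h2 : (2 : k) = 0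
  · have h12 := u_pow_twelve (smul_eq_self σ)
    set v := ((substitution W σ).u : k)
    -- `T⁴ - 1 = (T - 1)⁴` in characteristic two
    have : (v ^ 3 - 1) ^ 4 = 0 := by
      linear_combination h12 + (-2 * v ^ 9 + 3 * v ^ 6 - 2 * v ^ 3 + 1) * h2
    exact sub_eq_zero.1 (pow_eq_zero_iff (by norm_num) |>.1 this)
  · exact u_pow_three_eq_one_of_two_ne_zero G hG h2 hσ

/-- An involution `σ ∈ G` would have `u² = 1 = u³`, hence `u = 1`, and would fix `x`. -/
theorem card_ne_two [W.IsElliptic] (G : Subgroup (originAut W))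
    (hG : ∀ σ ∈ G, σ.1 (xFun W) = xFun W → σ = 1) : Nat.card G ≠ 2 := by
  intro hcard
  have : Nontrivial G := (Nat.card_eq_two_iff.1 hcard).elim fun a ⟨b, h, _⟩ => ⟨a, b, h⟩
  obtain ⟨⟨σ, hσ⟩, hne⟩ := exists_ne (1 : G)
  have hne : σ ≠ 1 := fun h => hne (Subtype.ext h)
  have hsq : σ ^ 2 = 1 := by
    have := pow_card_eq_one' (x := (⟨σ, hσ⟩ : G))
    rw [hcard] at this
    exact congrArg Subtype.val this
  have hu2 : ((substitution W σ).u : k) ^ 2 = 1 := by rw [← u_pow, hsq, u_one]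
  have hu3 := u_pow_three_eq_one G hG hσ
  have hu : ((substitution W σ).u : k) = 1 := by
    linear_combination hu3 - ((substitution W σ).u : k) * hu2
  by_cases h2 : (2 : k) = 0
  · exact hne (eq_one_of_u_eq_one_of_two_eq_zero G hG h2 hσ hu)
  · refine hne (hG _ hσ (apply_xFun_eq_self hu2 ?_))
    have h := r_mul σ σ
    rw [← pow_two, hsq, map_one, hu] at h
    change (0 : k) = _ at h
    exact (mul_eq_zero.1 (by linear_combination -h : 2 * (substitution W σ).r = 0)).resolve_left h2

theorem exists_poleOrder_eq_three {b : k} (hb : b ≠ 0) (s t : k) :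
    ∃ a : CRing W, algebraMap (CRing W) (FunField W) a = κ b * yFun W + κ s * xFun W + κ t ∧
      poleOrder a = 3 := by
  refine ⟨aeval (xCoord W) (C s * X + C t) + aeval (xCoord W) (C b) * yCoord W, ?_, ?_⟩
  · rw [algebraMap_aeval_add]
    simp only [map_add, map_mul, aeval_X, aeval_C]
    ring
  · refine eq_of_forall_ge_iff fun n => ?_
    rw [poleOrder_le_iff]
    have := natDegree_linear_le (a := s) (b := t)
    simp only [natDegree_C, C_eq_zero, hb, false_or]
    omega

/-- In characteristic other than two, `2y + a₁x + a₃` is multiplied by `u³ = 1`. In characteristic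
two, `u` embeds `G` into the cube roots of unity, and the trace of `y` is invariant. -/
theorem exists_invariant_poleOrder_three [W.IsElliptic] (G : Subgroup (originAut W)) (hGne : G ≠ ⊥)
    (hG : ∀ σ ∈ G, σ.1 (xFun W) = xFun W → σ = 1) :
    ∃ a : CRing W, poleOrder a = 3 ∧ ∀ σ ∈ G, σ.1 (algebraMap (CRing W) (FunField W) a) =
      algebraMap (CRing W) (FunField W) a := by
  by_cases h2 : (2 : k) = 0
  · obtain ⟨⟨σ, hσ⟩, hσ1⟩ := Subgroup.ne_bot_iff_exists_ne_one.1 hGne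
    have hne : σ ≠ 1 := fun h => hσ1 (Subtype.ext h)
    have hu3 := u_pow_three_eq_one G hG hσ
    have heq : ∀ τ ∈ G, ((substitution W τ).u : k) = 1 → τ = 1 := fun τ hτ h =>
      eq_one_of_u_eq_one_of_two_eq_zero G hG h2 hτ h
    have hσ3 : σ ^ 3 = 1 := heq _ (pow_mem hσ 3) (by rw [u_pow, hu3])
    obtain ⟨D, hD⟩ : ∃ D, substitution W σ = D := ⟨_, rfl⟩
    have hs := isSubstitution σ
    rw [hD] at hs hu3
    set u : k := (D.u : k)
    have hu1 : u - 1 ≠ 0 := fun h => hne (heq _ hσ (by rw [hD]; exact sub_eq_zero.1 h))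
    have hu : u ^ 2 + u + 1 = 0 :=
      (mul_eq_zero.1 (by linear_combination hu3 : (u - 1) * (u ^ 2 + u + 1) = 0)).resolve_left hu1
    -- the trace of `y` has leading coefficient `1 + u³ + u⁶ = 3 = 1`
    obtain ⟨a, ha, ha3⟩ := exists_poleOrder_eq_three (W := W) (b := 1) one_ne_zero
      (u ^ 2 * D.s * (1 + u ^ 3 + u ^ 2)) (D.t * (1 + u ^ 3 + 1) + u ^ 2 * D.s * D.r)
    have htr : algebraMap (CRing W) (FunField W) a =
        yFun W + σ.1 (yFun W) + σ.1 (σ.1 (yFun W)) := by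
      have h3 : κ u ^ 3 = 1 := by rw [← map_pow, hu3, map_one]
      have h2' : (2 : FunField W) = 0 := by rw [← map_ofNat κ 2, h2, map_zero]
      rw [ha, hs.map_y]
      simp only [map_add, map_mul, map_pow, AlgEquiv.commutes, hs.map_x, hs.map_y, map_one]
      linear_combination -(κ u ^ 3 + 2) * yFun W * h3 - yFun W * h2'
    have hinv : σ.1 (ι a) = ι a := by
      have : σ.1 (σ.1 (σ.1 (yFun W))) = yFun W :=
        congrArg (fun τ : originAut W => τ.1 (yFun W)) hσ3
      rw [htr, map_add, map_add, this]
      ring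
    refine ⟨a, ha3, fun τ hτ => ?_⟩
    -- `u` embeds `G` into the cube roots of unity `1, u, u²`
    have hτ3 := u_pow_three_eq_one G hG hτ
    set v : k := ((substitution W τ).u : k)
    have hv : (v - 1) * ((v - u) * (v - u ^ 2)) = 0 := by
      linear_combination hτ3 + (v - v ^ 2) * hu + (v - 1) * hu3
    rcases mul_eq_zero.1 hv with h | h
    · rw [heq τ hτ (sub_eq_zero.1 h)]; rfl
    rcases mul_eq_zero.1 h with h | h
    · have h1 : τ * σ ^ 2 = 1 := heq _ (mul_mem hτ (pow_mem hσ 2)) (by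
        rw [u_mul, u_pow, hD]
        change v * u ^ 2 = 1
        linear_combination u ^ 2 * h + hu3)
      have : τ = σ := by
        rw [eq_inv_of_mul_eq_one_left h1, inv_eq_iff_mul_eq_one, ← pow_succ, hσ3]
      rw [this, hinv]
    · have h1 : τ * σ = 1 := heq _ (mul_mem hτ hσ) (by
        rw [u_mul, hD]
        change v * u = 1
        linear_combination u * h + hu3)
      have h1 := congrArg (fun ρ : originAut W => ρ.1 (algebraMap (CRing W) (FunField W) a)) h1
      change τ.1 (σ.1 _) = _ at h1
      rwa [hinv] at h1
  · obtain ⟨a, ha, ha3⟩ := exists_poleOrder_eq_three (W := W) h2 W.a₁ W.a₃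
    refine ⟨a, ha3, fun σ hσ => ?_⟩
    have h3 : κ (substitution W σ).u ^ 3 = 1 := by
      rw [← map_pow, u_pow_three_eq_one G hG hσ, map_one]
    obtain ⟨h1, h3', -⟩ := relations_of_smul_eq (smul_eq_self σ)
    replace h1 := congrArg κ h1
    replace h3' := congrArg κ h3'
    simp only [map_add, map_mul, map_pow, map_ofNat] at h1 h3'
    rw [ha, map_add, map_add, map_mul, map_mul, AlgEquiv.commutes, AlgEquiv.commutes,
      AlgEquiv.commutes, (isSubstitution σ).map_x, (isSubstitution σ).map_y, map_ofNat]
    linear_combination (2 * yFun W + κ W.a₁ * xFun W + κ W.a₃) * h3 -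
      κ (substitution W σ).u ^ 2 * xFun W * h1 - h3'

/-! ### A generator of the ring of invariants -/

open scoped Classical in
/-- The conjugates of the coordinate function `x` under `G`. -/
def xOrbit (G : Subgroup (originAut W)) [Fintype G] : Finset (FunField W) :=
  Finset.univ.image fun σ : G => σ.1.1 (xFun W)

theorem mem_xOrbit {G : Subgroup (originAut W)} [Fintype G] {z : FunField W} :
    z ∈ xOrbit G ↔ ∃ σ ∈ G, σ.1 (xFun W) = z := by
  simp [xOrbit]

theorem xOrbit_card_pos (G : Subgroup (originAut W)) [Fintype G] : 0 < (xOrbit G).card :=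
  Finset.card_pos.2 ⟨_, mem_xOrbit.2 ⟨1, one_mem _, rfl⟩⟩

/-- The span of the `aʲxⁱ` with `i < h` consists of the sums `∑ cᵢ xⁱ` with `cᵢ ∈ k[a]`. -/
theorem exists_sum_of_mem_span {h : ℕ} {a b : CRing W}
    (hb : b ∈ Submodule.span k
      (Set.range fun ij : Fin h × ℕ => a ^ ij.2 * xCoord W ^ (ij.1 : ℕ))) :
    ∃ c : Fin h → k[X], b = ∑ i, aeval a (c i) * xCoord W ^ (i : ℕ) := by
  induction hb using Submodule.span_induction with
  | mem _ hx =>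
    obtain ⟨⟨i, j⟩, rfl⟩ := hx
    refine ⟨Pi.single i (X ^ j), ?_⟩
    rw [Finset.sum_eq_single i]
    · simp
    · intro l _ hl
      rw [Pi.single_eq_of_ne hl, map_zero, zero_mul]
    · simp
  | zero => exact ⟨0, by simp⟩
  | add _ _ _ _ h1 h2 =>
    obtain ⟨c, rfl⟩ := h1
    obtain ⟨d, rfl⟩ := h2
    exact ⟨c + d, by simp [add_mul, Finset.sum_add_distrib]⟩
  | smul r _ _ h =>
    obtain ⟨c, rfl⟩ := h
    exact ⟨r • c, by simp [Finset.smul_sum]⟩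

variable (G : Subgroup (originAut W)) [Fintype G]

theorem apply_algebraMap_aeval {σ : originAut W} {a : CRing W} (ha : σ.1 (ι a) = ι a) (q : k[X]) :
    σ.1 (ι (aeval a q)) = ι (aeval a q) := by
  rw [← aeval_algebraMap_apply, ← aeval_algHom_apply, ha]

/-- A polynomial with invariant coefficients and root `x` also has the conjugates of `x` as roots, so
it is zero if its degree is less than their number. -/
theorem eq_zero_of_eval_xFun_eq_zero {P : (FunField W)[X]}
    (hP : ∀ σ ∈ G, P.map (σ.1 : FunField W →+* FunField W) = P) (h0 : P.eval (xFun W) = 0)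
    (hd : P.natDegree < (xOrbit G).card) : P = 0 := by
  refine eq_zero_of_natDegree_lt_card_of_eval_eq_zero' P (xOrbit G) (fun z hz => ?_) hd
  obtain ⟨σ, hσ, rfl⟩ := mem_xOrbit.1 hz
  have := congrArg (σ.1 : FunField W →+* FunField W) h0
  rw [map_zero, ← eval_map_apply, hP σ hσ] at this
  exact this

/-- If `b = ∑ cᵢ xⁱ` with `cᵢ ∈ k[a]`, where `i` is less than the number of conjugates of `x`, then
`∑ cᵢ Tⁱ - b` has more roots than its degree, so `b = c₀`. -/
theorem exists_aeval_eq_of_mem_span {a b : CRing W} (ha : ∀ σ ∈ G, σ.1 (ι a) = ι a)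
    (hb : ∀ σ ∈ G, σ.1 (ι b) = ι b) (hmem : b ∈ Submodule.span k
      (Set.range fun ij : Fin (xOrbit G).card × ℕ => a ^ ij.2 * xCoord W ^ (ij.1 : ℕ))) :
    ∃ q : k[X], b = aeval a q := by
  obtain ⟨c, hc⟩ := exists_sum_of_mem_span hmem
  have hpos := xOrbit_card_pos G
  let P : (FunField W)[X] := ∑ i, C (ι (aeval a (c i))) * X ^ (i : ℕ) - C (ι b)
  have hP : P = 0 := by
    refine eq_zero_of_eval_xFun_eq_zero G (fun σ hσ => ?_) ?_ ?_
    · simp only [P, Polynomial.map_sub, Polynomial.map_sum, Polynomial.map_mul, map_C,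
        Polynomial.map_pow, map_X]
      congr 1
      · refine Finset.sum_congr rfl fun i _ => ?_
        congr 2
        exact apply_algebraMap_aeval (ha σ hσ) _
      · congr 1
        exact hb σ hσ
    · simp only [P, eval_sub, eval_finsetSum, eval_mul, eval_C, eval_pow, eval_X]
      rw [hc, map_sum, sub_eq_zero]
      refine Finset.sum_congr rfl fun i _ => ?_
      rw [map_mul, map_pow]
      rfl
    · rw [natDegree_sub_C]
      refine (natDegree_sum_le_of_forall_le _ _ (n := (xOrbit G).card - 1) fun i _ => ?_).trans_lt
        (by omega)
      exact (natDegree_C_mul_X_pow_le _ _).trans (by omega)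
  refine ⟨c ⟨0, hpos⟩, algebraMap_injective ?_⟩
  have h0 := congrArg (fun Q => coeff Q 0) hP
  simp only [P, coeff_sub, finsetSum_coeff, coeff_C_mul, coeff_X_pow, coeff_C_zero, coeff_zero]
    at h0
  rw [Finset.sum_eq_single ⟨0, hpos⟩] at h0
  · simp only [if_true, mul_one] at h0
    exact (sub_eq_zero.1 h0).symm
  · intro i _ hi
    rw [if_neg, mul_zero]
    exact fun h => hi (Fin.ext h.symm)
  · simp

/-- If `xⁿ` is a combination of lower powers of `x` over `k[a]`, then `x` is a root of a monic
polynomial of degree `n` with invariant coefficients. -/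
theorem card_xOrbit_le_of_mem_span {a : CRing W} (ha : ∀ σ ∈ G, σ.1 (ι a) = ι a) {n : ℕ}
    (hx : xCoord W ^ n ∈ Submodule.span k
      (Set.range fun ij : Fin n × ℕ => a ^ ij.2 * xCoord W ^ (ij.1 : ℕ))) :
    (xOrbit G).card ≤ n := by
  obtain ⟨c, hc⟩ := exists_sum_of_mem_span hx
  by_contra hlt
  let P : (FunField W)[X] := X ^ n - ∑ i : Fin n, C (ι (aeval a (c i))) * X ^ (i : ℕ)
  have hdeg : (∑ i : Fin n, C (ι (aeval a (c i))) * X ^ (i : ℕ) : (FunField W)[X]).degree <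
      (n : WithBot ℕ) := degree_sum_fin_lt fun i => ι (aeval a (c i))
  have hmonic : P.Monic := monic_X_pow_sub hdeg
  refine hmonic.ne_zero (eq_zero_of_eval_xFun_eq_zero G (fun σ hσ => ?_) ?_ ?_)
  · simp only [P, Polynomial.map_sub, Polynomial.map_sum, Polynomial.map_mul, map_C,
      Polynomial.map_pow, map_X]
    congr 1
    refine Finset.sum_congr rfl fun i _ => ?_
    congr 2
    exact apply_algebraMap_aeval (ha σ hσ) _
  · have := congrArg ι hc
    rw [map_pow, map_sum] at this
    simp only [P, eval_sub, eval_finsetSum, eval_mul, eval_C, eval_pow, eval_X]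
    rw [show xFun W ^ n = _ from this, sub_eq_zero]
    refine Finset.sum_congr rfl fun i _ => ?_
    rw [map_mul, map_pow]
    rfl
  · refine lt_of_le_of_lt ?_ (not_le.1 hlt)
    refine natDegree_le_of_degree_le ((degree_sub_le _ _).trans (max_le ?_ hdeg.le))
    exact degree_X_pow_le _

theorem card_xOrbit_eq_card (hG : ∀ σ ∈ G, σ.1 (xFun W) = xFun W → σ = 1) :
    (xOrbit G).card = Nat.card G := by
  classical
  rw [xOrbit, Finset.card_image_of_injective, Finset.card_univ, Nat.card_eq_fintype_card]
  intro σ τ h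
  have : (τ⁻¹ * σ).1 = 1 := by
    apply hG _ (τ⁻¹ * σ).2
    change τ.1.1.symm (σ.1.1 (xFun W)) = _
    simp only at h
    rw [h, AlgEquiv.symm_apply_apply]
  exact (inv_mul_eq_one.1 (Subtype.ext this : τ⁻¹ * σ = 1)).symm

/-- The generator of the invariants, if no element of `G` other than `1` fixes `x`. It turns out that
`G` is of order three. -/
theorem exists_generator_of_free [W.IsElliptic] (hGne : G ≠ ⊥)
    (hG : ∀ σ ∈ G, σ.1 (xFun W) = xFun W → σ = 1) :
    ∃ a : CRing W, poleOrder a = Nat.card G ∧ (∀ σ ∈ G, σ.1 (ι a) = ι a) ∧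
      ∀ b : CRing W, (∀ σ ∈ G, σ.1 (ι b) = ι b) → ∃ q : k[X], b = aeval a q := by
  obtain ⟨a, ha3, ha⟩ := exists_invariant_poleOrder_three G hGne hG
  have ha0 : a ≠ 0 := by rintro rfl; simp [poleOrder_zero] at ha3
  have hspan : (⊤ : Submodule k (CRing W)) ≤ Submodule.span k
      (Set.range fun ij : Fin 3 × ℕ => a ^ ij.2 * xCoord W ^ (ij.1 : ℕ)) := by
    refine le_span_range_of_poleOrder _ _ (fun _ => trivial)
      (fun ij => mul_ne_zero (pow_ne_zero _ ha0) (pow_ne_zero _ xCoord_ne_zero)) fun b _ _ => ?_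
    have h1 := poleOrder_ne_one b
    have hij : ∀ (i : Fin 3) (j : ℕ), poleOrder (a ^ j * xCoord W ^ (i : ℕ)) = 3 * j + 2 * i := by
      intro i j
      rw [poleOrder_mul (pow_ne_zero _ ha0) (pow_ne_zero _ xCoord_ne_zero), poleOrder_pow,
        poleOrder_pow, ha3, poleOrder_xCoord]
      ring
    rcases (by omega : poleOrder b % 3 = 0 ∨ poleOrder b % 3 = 1 ∨ poleOrder b % 3 = 2)
      with h | h | h
    · exact ⟨(0, poleOrder b / 3), by rw [hij]; simp only [Fin.val_zero]; omega⟩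
    · exact ⟨(2, poleOrder b / 3 - 1), by rw [hij]; simp only [Fin.val_two]; omega⟩
    · exact ⟨(1, poleOrder b / 3), by rw [hij]; simp only [Fin.val_one]; omega⟩
  have hcard := card_xOrbit_eq_card G hG
  have hle : (xOrbit G).card ≤ 3 := card_xOrbit_le_of_mem_span G ha (hspan trivial)
  have h3 : Nat.card G = 3 := by
    have h2 := card_ne_two G hG
    have : Nat.card G ≠ 1 := fun h => hGne (Subgroup.card_eq_one.1 h)
    have : 0 < Nat.card G := Nat.card_pos
    omega
  refine ⟨a, by rw [ha3, h3], ha, fun b hb => exists_aeval_eq_of_mem_span G ha hb ?_⟩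
  rw [hcard, h3]
  exact hspan trivial

/-- An automorphism that fixes `x` permutes the two roots of the Weierstrass equation over `k(x)`. -/
theorem apply_yFun_eq_or_eq {τ : FunField W ≃ₐ[k] FunField W}
    (hx : τ (xFun W) = xFun W) :
    τ (yFun W) = yFun W ∨ τ (yFun W) = -yFun W - κ W.a₁ * xFun W - κ W.a₃ := by
  have h := congrArg τ (yFun_sq (W := W))
  simp only [map_add, map_mul, map_pow, map_sub, hx, AlgEquiv.commutes] at h
  have : (τ (yFun W) - yFun W) * (τ (yFun W) + yFun W + κ W.a₁ * xFun W + κ W.a₃) = 0 := by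
    linear_combination h - yFun_sq (W := W)
  rcases mul_eq_zero.1 this with h | h
  · left; linear_combination h
  · right; linear_combination h

theorem eq_one_or_eq_of_apply_xFun {σ τ : originAut W} (hσ : σ ≠ 1)
    (hσx : σ.1 (xFun W) = xFun W) (hτx : τ.1 (xFun W) = xFun W) : τ = 1 ∨ τ = σ := by
  have hσy : σ.1 (yFun W) ≠ yFun W := fun h => hσ (Subtype.ext (algEquiv_ext hσx h))
  rcases apply_yFun_eq_or_eq hτx with h | h
  · exact Or.inl (Subtype.ext (algEquiv_ext hτx h))
  · refine Or.inr (Subtype.ext (algEquiv_ext (hτx.trans hσx.symm) ?_))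
    rw [h, (apply_yFun_eq_or_eq hσx).resolve_left hσy]

theorem card_eq_two_mul_card_xOrbit {σ : originAut W} (hσG : σ ∈ G) (hσ : σ ≠ 1)
    (hσx : σ.1 (xFun W) = xFun W) : Nat.card G = 2 * (xOrbit G).card := by
  classical
  rw [Nat.card_eq_fintype_card, ← Finset.card_univ,
    Finset.card_eq_sum_card_image (fun τ : G => τ.1.1 (xFun W)) Finset.univ, mul_comm,
    ← smul_eq_mul, ← Finset.sum_const]
  refine Finset.sum_congr (by rw [xOrbit]) fun z hz => ?_
  obtain ⟨τ, -, rfl⟩ := Finset.mem_image.1 hz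
  have hne : τ ≠ τ * ⟨σ, hσG⟩ := fun h => hσ (congrArg Subtype.val (left_eq_mul.1 h))
  rw [← Finset.card_pair hne]
  congr 1
  ext ρ
  simp only [Finset.mem_filter, Finset.mem_univ, true_and, Finset.mem_insert,
    Finset.mem_singleton]
  constructor
  · intro h
    have hx : (τ⁻¹ * ρ).1.1 (xFun W) = xFun W := by
      change τ.1.1.symm (ρ.1.1 (xFun W)) = _
      rw [h, AlgEquiv.symm_apply_apply]
    rcases eq_one_or_eq_of_apply_xFun hσ hσx hx with h | h
    · left
      exact (inv_mul_eq_one.1 (Subtype.ext h : τ⁻¹ * ρ = 1)).symm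
    · right
      exact inv_mul_eq_iff_eq_mul.1 (Subtype.ext h : τ⁻¹ * ρ = ⟨σ, hσG⟩)
  · rintro (rfl | rfl)
    · rfl
    · exact congrArg τ.1.1 hσx

/-- The generator of the invariants, if some element of `G` other than `1` fixes `x`: the product of
the conjugates of `x`, a polynomial of degree `|G| / 2` in `x`. -/
theorem exists_generator_of_not_free {σ : originAut W} (hσG : σ ∈ G) (hσ : σ ≠ 1)
    (hσx : σ.1 (xFun W) = xFun W) :
    ∃ a : CRing W, poleOrder a = Nat.card G ∧ (∀ σ ∈ G, σ.1 (ι a) = ι a) ∧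
      ∀ b : CRing W, (∀ σ ∈ G, σ.1 (ι b) = ι b) → ∃ q : k[X], b = aeval a q := by
  classical
  have hz : ∀ z ∈ xOrbit G, ∃ p : k[X], p.natDegree = 1 ∧ aeval (xFun W) p = z := by
    intro z hz
    obtain ⟨τ, hτ, rfl⟩ := mem_xOrbit.1 hz
    refine ⟨C ((substitution W τ).u ^ 2 : k) * X + C (substitution W τ).r,
      natDegree_linear (pow_ne_zero _ (Units.ne_zero _)), ?_⟩
    rw [(isSubstitution τ).map_x]
    simp
  choose! p hp1 hp using hz
  have hpne : ∀ z ∈ xOrbit G, p z ≠ 0 := fun z hz h => by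
    have := hp1 z hz
    simp [h] at this
  let P : k[X] := ∏ z ∈ xOrbit G, p z
  have hP : P.natDegree = (xOrbit G).card := by
    rw [natDegree_prod _ _ hpne, Finset.sum_congr rfl hp1, Finset.sum_const, smul_eq_mul, mul_one]
  have hP0 : P ≠ 0 := Finset.prod_ne_zero_iff.2 hpne
  have hιP : ι (aeval (xCoord W) P) = ∏ z ∈ xOrbit G, z := by
    rw [algebraMap_aeval_xCoord, map_prod]
    exact Finset.prod_congr rfl hp
  set h := (xOrbit G).card with hh
  have hpos : 0 < h := xOrbit_card_pos G
  set a := aeval (xCoord W) P with hadef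
  have ha : poleOrder a = 2 * h := by rw [poleOrder_aeval, hP]
  have ha0 : a ≠ 0 := fun h0 => by rw [h0, poleOrder_zero] at ha; omega
  have hainv : ∀ τ ∈ G, τ.1 (ι a) = ι a := by
    intro τ hτ
    rw [hιP, map_prod]
    refine Finset.prod_bij (fun z _ => τ.1 z) (fun z hz => ?_) (fun _ _ _ _ h => τ.1.injective h)
      (fun z hz => ?_) (fun _ _ => rfl)
    · obtain ⟨ρ, hρ, rfl⟩ := mem_xOrbit.1 hz
      exact mem_xOrbit.2 ⟨τ * ρ, mul_mem hτ hρ, rfl⟩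
    · obtain ⟨ρ, hρ, rfl⟩ := mem_xOrbit.1 hz
      exact ⟨_, mem_xOrbit.2 ⟨τ⁻¹ * ρ, mul_mem (inv_mem hτ) hρ, rfl⟩, τ.1.apply_symm_apply _⟩
  refine ⟨a, by rw [ha, card_eq_two_mul_card_xOrbit G hσG hσ hσx], hainv, fun b hb => ?_⟩
  refine exists_aeval_eq_of_mem_span G hainv hb ?_
  have hspan : LinearMap.range (aeval (R := k) (xCoord W)).toLinearMap ≤ Submodule.span k
      (Set.range fun ij : Fin h × ℕ => a ^ ij.2 * xCoord W ^ (ij.1 : ℕ)) := by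
    refine le_span_range_of_poleOrder _ _ (fun ij => ⟨P ^ ij.2 * X ^ (ij.1 : ℕ), by simp [a]⟩)
      (fun ij => mul_ne_zero (pow_ne_zero _ ha0) (pow_ne_zero _ xCoord_ne_zero)) ?_
    rintro _ ⟨q, rfl⟩ -
    refine ⟨(⟨q.natDegree % h, Nat.mod_lt _ hpos⟩, q.natDegree / h), ?_⟩
    rw [poleOrder_mul (pow_ne_zero _ ha0) (pow_ne_zero _ xCoord_ne_zero), poleOrder_pow,
      poleOrder_pow, ha, poleOrder_xCoord]
    refine Eq.trans ?_ (poleOrder_aeval q).symm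
    have := Nat.div_add_mod q.natDegree h
    simp only
    linear_combination 2 * this
  apply hspan
  obtain ⟨p, q, rfl⟩ := exists_eq_aeval_add b
  have hσy : σ.1 (yFun W) ≠ yFun W := fun h => hσ (Subtype.ext (algEquiv_ext hσx h))
  have hb := hb σ hσG
  rw [algebraMap_aeval_add] at hb
  simp only [map_add, map_mul, ← aeval_algHom_apply, hσx] at hb
  have hq : aeval (xFun W) q = 0 := by
    refine (mul_eq_zero.1 ?_).resolve_right (sub_ne_zero.2 hσy)
    linear_combination hb
  obtain ⟨-, rfl⟩ := aeval_xFun_add_eq_zero (W := W) (p := 0) (q := q) (by simp [hq])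
  exact ⟨p, by simp⟩

/-! ### The graded ring -/

/-- The invariants of `G` in the coordinate ring are the polynomials in one function, whose pole
order is the order of `G`. -/
theorem exists_generator [W.IsElliptic] (G : Subgroup (originAut W)) (hGne : G ≠ ⊥) :
    ∃ a : CRing W, poleOrder a = Nat.card G ∧ (∀ σ ∈ G, σ.1 (ι a) = ι a) ∧
      ∀ b : CRing W, (∀ σ ∈ G, σ.1 (ι b) = ι b) → ∃ q : k[X], b = aeval a q := by
  have := finite_originAut (W := W)
  have := Fintype.ofFinite G
  by_cases hG : ∀ σ ∈ G, σ.1 (xFun W) = xFun W → σ = 1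
  · exact exists_generator_of_free G hGne hG
  · push Not at hG
    obtain ⟨σ, hσG, hσx, hσ⟩ := hG
    exact exists_generator_of_not_free G hσG hσ hσx

theorem poleOrder_aeval_le (a : CRing W) (q : k[X]) :
    poleOrder (aeval a q) ≤ q.natDegree * poleOrder a := by
  rw [← mem_functionsOfPoleOrderLE, aeval_eq_sum_range]
  refine Submodule.sum_mem _ fun i hi => Submodule.smul_mem _ _ ?_
  rw [mem_functionsOfPoleOrderLE, poleOrder_pow]
  exact Nat.mul_le_mul_right _ (Nat.lt_succ_iff.1 (Finset.mem_range.1 hi))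

theorem poleOrder_aeval_eq {a : CRing W} (ha : 0 < poleOrder a) (q : k[X]) :
    poleOrder (aeval a q) = q.natDegree * poleOrder a := by
  refine le_antisymm (poleOrder_aeval_le a q) ?_
  rcases Nat.eq_zero_or_pos q.natDegree with h0 | hpos
  · rw [h0, zero_mul]; exact Nat.zero_le _
  by_contra hlt
  have hq : q ≠ 0 := fun h => by simp [h] at hpos
  have hd : (q.natDegree - 1) * poleOrder a + poleOrder a = q.natDegree * poleOrder a := by
    rw [← Nat.succ_mul, Nat.succ_eq_add_one, Nat.sub_add_cancel hpos]
  have h1 : aeval a q ∈ functionsOfPoleOrderLE W (q.natDegree * poleOrder a - 1) := by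
    rw [mem_functionsOfPoleOrderLE]; omega
  have h2 : aeval a q.eraseLead ∈ functionsOfPoleOrderLE W (q.natDegree * poleOrder a - 1) := by
    rw [mem_functionsOfPoleOrderLE]
    have h3 := poleOrder_aeval_le a q.eraseLead
    have h4 := Nat.mul_le_mul_right (poleOrder a) q.eraseLead_natDegree_le
    omega
  have h3 : aeval a q = aeval a q.eraseLead + q.leadingCoeff • a ^ q.natDegree := by
    conv_lhs => rw [← q.eraseLead_add_C_mul_X_pow]
    rw [map_add, map_mul, aeval_C, map_pow, aeval_X, Algebra.smul_def]
  have h4 := Submodule.sub_mem _ h1 h2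
  rw [h3, add_sub_cancel_left, Submodule.smul_mem_iff _ (leadingCoeff_ne_zero.2 hq),
    mem_functionsOfPoleOrderLE, poleOrder_pow] at h4
  omega

theorem eq_zero_of_aeval_eq_zero {a : CRing W} (ha : 0 < poleOrder a) {q : k[X]}
    (hq : aeval a q = 0) : q = 0 := by
  have h := poleOrder_aeval_eq ha q
  rw [hq, poleOrder_zero, eq_comm, mul_eq_zero] at h
  obtain ⟨c, rfl⟩ : ∃ c, q = C c := ⟨_, eq_C_of_natDegree_eq_zero (h.resolve_right ha.ne')⟩
  rw [aeval_C] at hq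
  rw [(map_eq_zero_iff _ (algebraMap k (CRing W)).injective).1 hq, C_0]

theorem mem_invariantSections {G : Subgroup (originAut W)} {n : ℕ} {f : FunField W} :
    f ∈ invariantSections W G n ↔ f ∈ sections W n ∧ ∀ σ ∈ G, σ.1 f = f := Iff.rfl

variable (G : Subgroup (originAut W)) (m : ℕ)

/-- The realisation of the graded ring as a subring of the polynomial ring over the function field,
sending `f` in degree `d` to `f Tᵈ`. -/
def toPolynomial : InvariantRing W G m →ₐ[k] (FunField W)[X] :=
  DirectSum.toAlgebra k (fun d : ℕ => invariantSections W G (d * m))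
    (fun d => ((monomial d).restrictScalars k).comp (invariantSections W G (d * m)).subtype)
    (by rfl)
    (fun {i j} f g => by
      change monomial (i + j) ((f : FunField W) * (g : FunField W)) =
        monomial i (f : FunField W) * monomial j (g : FunField W)
      rw [monomial_mul_monomial])

theorem toPolynomial_lof (d : ℕ) (f : invariantSections W G (d * m)) :
    toPolynomial G m (DirectSum.lof k ℕ (fun d : ℕ => invariantSections W G (d * m)) d f) =
      monomial d (f : FunField W) := by
  exact DirectSum.toModule_lof (M := fun d : ℕ => invariantSections W G (d * m)) (φ := fun d =>
    ((monomial d).restrictScalars k).comp (invariantSections W G (d * m)).subtype) k d f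

theorem coeff_toPolynomial (z : InvariantRing W G m) (d : ℕ) :
    (toPolynomial G m z).coeff d = (z d : FunField W) := by
  induction z using DirectSum.induction_on with
  | zero => simp
  | of i f =>
    have := toPolynomial_lof G m i f
    rw [DirectSum.lof_eq_of] at this
    rw [this, coeff_monomial]
    split_ifs with h
    · subst h
      rw [DirectSum.of_eq_same]
    · rw [DirectSum.of_eq_of_ne _ _ _ (Ne.symm h)]
      rfl
  | add z w hz hw => rw [map_add, coeff_add, hz, hw]; rfl

theorem toPolynomial_injective : Function.Injective (toPolynomial G m) := by
  intro z w h
  refine DFinsupp.ext fun d => Subtype.ext ?_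
  rw [← coeff_toPolynomial, h, coeff_toPolynomial]

variable {G m}

/-- The algebra map that sends the first variable to the function `1` in degree `1` and the second
one to the function `f` in degree `N`. -/
def ofGenerator (N : ℕ) (f : invariantSections W G (N * m)) :
    MvPolynomial (Fin 2) k →ₐ[k] InvariantRing W G m :=
  MvPolynomial.aeval ![
    DirectSum.lof k ℕ (fun d : ℕ => invariantSections W G (d * m)) 1
      ⟨1, mem_invariantSections.2 ⟨mem_sections.2 ⟨1, map_one _, by simp [poleOrder_one]⟩,
        fun σ _ => map_one σ.1⟩⟩,
    DirectSum.lof k ℕ (fun d : ℕ => invariantSections W G (d * m)) N f]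

theorem toPolynomial_ofGenerator_monomial (N : ℕ) (f : invariantSections W G (N * m))
    (s : Fin 2 →₀ ℕ) (c : k) :
    toPolynomial G m (ofGenerator N f (MvPolynomial.monomial s c)) =
      monomial (s 0 + s 1 * N) (κ c * (f : FunField W) ^ s 1) := by
  rw [ofGenerator, MvPolynomial.aeval_monomial, Finsupp.prod_fintype _ _ (by simp),
    Fin.prod_univ_two, map_mul, map_mul, map_pow, map_pow, AlgHom.commutes]
  simp only [Matrix.cons_val_zero, Matrix.cons_val_one]
  rw [toPolynomial_lof, toPolynomial_lof, monomial_pow, monomial_pow,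
    monomial_mul_monomial, IsScalarTower.algebraMap_apply k (FunField W) (FunField W)[X],
    algebraMap_eq, C_mul_monomial]
  simp [mul_comm N]

theorem weight_fin_two (N : ℕ) (s : Fin 2 →₀ ℕ) :
    Finsupp.weight ![1, N] s = s 0 + s 1 * N := by
  rw [Finsupp.weight_apply, Finsupp.sum_fintype _ _ (by simp), Fin.sum_univ_two]
  simp

theorem coeff_toPolynomial_ofGenerator (N : ℕ) (f : invariantSections W G (N * m))
    (p : MvPolynomial (Fin 2) k) (d : ℕ) :
    (toPolynomial G m (ofGenerator N f p)).coeff d =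
      aeval (f : FunField W) (∑ s ∈ p.support with s 0 + s 1 * N = d,
        monomial (s 1) (p.coeff s)) := by
  conv_lhs => rw [p.as_sum]
  rw [map_sum, map_sum, finsetSum_coeff, map_sum, Finset.sum_filter]
  refine Finset.sum_congr rfl fun s _ => ?_
  rw [toPolynomial_ofGenerator_monomial, coeff_monomial, aeval_monomial]

theorem ofGenerator_injective {N : ℕ} {f : invariantSections W G (N * m)} {a : CRing W}
    (hf : ι a = f) (ha : 0 < poleOrder a) : Function.Injective (ofGenerator N f) := by
  rw [injective_iff_map_eq_zero]
  intro p hp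
  ext s
  by_contra hs
  rw [MvPolynomial.coeff_zero] at hs
  have h := coeff_toPolynomial_ofGenerator N f p (s 0 + s 1 * N)
  rw [hp, map_zero, coeff_zero, ← hf, aeval_algebraMap_apply] at h
  have h := eq_zero_of_aeval_eq_zero ha (algebraMap_injective (by rw [← h, map_zero]))
  have h := congrArg (fun q => coeff q (s 1)) h
  simp only [finsetSum_coeff, coeff_zero] at h
  rw [Finset.sum_eq_single s] at h
  · rw [coeff_monomial_same] at h
    exact hs h
  · intro t ht hts
    rw [coeff_monomial, if_neg]
    intro h1
    have := (Finset.mem_filter.1 ht).2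
    rw [h1] at this
    apply hts
    ext i
    fin_cases i
    · exact Nat.add_right_cancel this
    · exact h1
  · intro hns
    exact (hns (Finset.mem_filter.2 ⟨MvPolynomial.mem_support_iff.2 hs, rfl⟩)).elim

theorem ofGenerator_mem_range_lof {N d : ℕ} (f : invariantSections W G (N * m))
    {p : MvPolynomial (Fin 2) k} (hp : p ∈ MvPolynomial.weightedHomogeneousSubmodule k ![1, N] d) :
    ofGenerator N f p ∈ LinearMap.range
      (DirectSum.lof k ℕ (fun d : ℕ => invariantSections W G (d * m)) d) := by
  refine ⟨ofGenerator N f p d, toPolynomial_injective G m ?_⟩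
  ext e
  rw [toPolynomial_lof, coeff_monomial]
  split_ifs with h
  · rw [← h, coeff_toPolynomial]
  · rw [coeff_toPolynomial_ofGenerator, Finset.filter_false_of_mem, Finset.sum_empty, map_zero]
    intro s hs
    rw [← weight_fin_two, hp (MvPolynomial.mem_support_iff.1 hs)]
    exact h

theorem range_lof_le_map_ofGenerator {N : ℕ} {f : invariantSections W G (N * m)} {a : CRing W}
    (hf : ι a = f) (ha : 0 < poleOrder a) (hN : poleOrder a = N * m)
    (hgen : ∀ b : CRing W, (∀ σ ∈ G, σ.1 (ι b) = ι b) → ∃ q : k[X], b = aeval a q) (d : ℕ) :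
    LinearMap.range (DirectSum.lof k ℕ (fun d : ℕ => invariantSections W G (d * m)) d) ≤
      (MvPolynomial.weightedHomogeneousSubmodule k ![1, N] d).map
        (ofGenerator N f).toLinearMap := by
  rintro _ ⟨⟨g, hg⟩, rfl⟩
  obtain ⟨⟨b, rfl, hb⟩, hinv⟩ := mem_invariantSections.1 hg |>.imp mem_sections.1 id
  obtain ⟨q, rfl⟩ := hgen b hinv
  rw [poleOrder_aeval_eq ha, hN, ← mul_assoc] at hb
  have hm : 0 < m := Nat.pos_of_ne_zero fun h => by rw [hN, h] at ha; omega
  have hd := Nat.le_of_mul_le_mul_right hb hm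
  have hj : ∀ j ∈ Finset.range (q.natDegree + 1), d - j * N + j * N = d := fun j hj =>
    Nat.sub_add_cancel ((Nat.mul_le_mul_right N
      (Nat.lt_succ_iff.1 (Finset.mem_range.1 hj))).trans hd)
  let s : ℕ → Fin 2 →₀ ℕ := fun j => Finsupp.single 0 (d - j * N) + Finsupp.single 1 j
  have hs0 : ∀ j, s j 0 = d - j * N := fun j => by simp [s]
  have hs1 : ∀ j, s j 1 = j := fun j => by simp [s]
  refine ⟨∑ j ∈ Finset.range (q.natDegree + 1), MvPolynomial.monomial (s j) (q.coeff j), ?_, ?_⟩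
  · refine Submodule.sum_mem _ fun j hjm => ?_
    refine MvPolynomial.isWeightedHomogeneous_monomial _ _ _ ?_
    rw [weight_fin_two, hs0, hs1, hj j hjm]
  · apply toPolynomial_injective G m
    rw [toPolynomial_lof, AlgHom.toLinearMap_apply, map_sum, map_sum]
    change _ = monomial d (ι (aeval a q))
    rw [← aeval_algebraMap_apply, hf,
      aeval_eq_sum_range, map_sum]
    refine Finset.sum_congr rfl fun j hjm => ?_
    rw [toPolynomial_ofGenerator_monomial, hs0, hs1, hj j hjm, Algebra.smul_def]

end

end EllipticInvariants

theorem mainTheorem5 {k : Type*} [Field k] (W : WeierstrassCurve k) [W.IsElliptic]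
    (G : Subgroup (EllipticInvariants.originAut W)) (hG : G ≠ ⊥)
    (m : ℕ) (hm : m ∣ Nat.card G) :
    ∃ e : MvPolynomial (Fin 2) k ≃ₐ[k] EllipticInvariants.InvariantRing W G m,
      ∀ d : ℕ,
        (MvPolynomial.weightedHomogeneousSubmodule k ![1, Nat.card G / m] d).map
            e.toLinearMap =
          LinearMap.range (DirectSum.lof k ℕ
            (fun d : ℕ => EllipticInvariants.invariantSections W G (d * m)) d) := by
  open EllipticInvariants in
  obtain ⟨a, ha, hinv, hgen⟩ := exists_generator G hG
  have := finite_originAut (W := W)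
  have hpos : 0 < poleOrder a := ha ▸ Nat.card_pos
  have hN : poleOrder a = Nat.card G / m * m := by rw [ha, Nat.div_mul_cancel hm]
  let f : invariantSections W G (Nat.card G / m * m) :=
    ⟨algebraMap _ _ a, mem_invariantSections.2 ⟨mem_sections.2 ⟨a, rfl, hN.le⟩, hinv⟩⟩
  have hle := range_lof_le_map_ofGenerator (f := f) rfl hpos hN hgen
  have hsurj : Function.Surjective (ofGenerator _ f) := by
    intro z
    induction z using DirectSum.induction_on with
    | zero => exact ⟨0, map_zero _⟩
    | of d g =>
      obtain ⟨p, -, hp⟩ := hle d ⟨g, rfl⟩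
      exact ⟨p, hp⟩
    | add z w hz hw =>
      obtain ⟨p, rfl⟩ := hz
      obtain ⟨q, rfl⟩ := hw
      exact ⟨p + q, map_add _ _ _⟩
  refine ⟨AlgEquiv.ofBijective (ofGenerator _ f) ⟨ofGenerator_injective rfl hpos, hsurj⟩,
    fun d => le_antisymm ?_ (hle d)⟩
  rintro _ ⟨p, hp, rfl⟩
  exact ofGenerator_mem_range_lof f hp
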